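/- Let $(P,d,\mu)$ be a metric space with a $\sigma$-finite Borel regular measure $\mu$ such that every ball has finite positive measure; assume that $\mu$ is non-atomic and doubling, i.e., there is $C\ge 1$ with $\mu(B(x,2r))\le C\,\mu(B(x,r))$ for all $x\in P$, $r>0$. Let $\mathcal M(P,\mu)$ be the set of extended real-valued $\mu$-measurable functions on $P$ (defined everywhere). Let $X$ be a quasi-Banach function lattice over $(P,\mu)$, i.e., $X=\{u\in\mathcal M(P,\mu):\|u\|_X<\infty\}$, where $\|\cdot\|_X:\mathcal M(P,\mu)\to[0,\infty]$ and, for some constant $c\ge 1$: $\|u\|_X=0$ iff $u=0$ a.e.; $\|au\|_X=|a|\,\|u\|_X$ for $a\in\mathbb R$; $\|u+v\|_X\le c(\|u\|_X+\|v\|_X)$; $|u|\le|v|$ a.e. implies $\|u\|_X\le\|v\|_X$; $\bigl\|\sum_{n\ge1}u_n\bigr\|_X\le\sum_{n\ge1}c^n\|u_n\|_X$ whenever $u_n\ge0$ a.e. for all $n$; and $\|u_n-u\|_X\to0$ implies $\|u_n\|_X\to\|u\|_X$. Assume that the quasi-norm is absolutely continuous: for every $u\in X$ we have $\|u\chi_{E_n}\|_X\to0$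 whenever $(E_n)$ is a decreasing sequence of measurable sets with $\mu(\bigcap_nE_n)=0$. A Borel function $g:P\to[0,\infty]$ is an upper gradient of $u:P\to[-\infty,\infty]$ if $|u(\gamma(0))-u(\gamma(l))|\le\int_\gamma g\,ds$ for every non-constant rectifiable curve $\gamma:[0,l]\to P$ parametrized by arc length, where $|(\pm\infty)-(\pm\infty)|=\infty$. Let $\|u\|_{N^1X}=\|u\|_X+\inf_g\|g\|_X$, the infimum being taken over all upper gradients $g$ of $u$, and $N^1X=\{u\in\mathcal M(P,\mu):\|u\|_{N^1X}<\infty\}$. For $v\in L^1_{\mathrm{loc}}(P)$ (that is, $v$ is integrable over every ball) let $$v^\sharp_1(x)=\sup_{r>0}\frac1r\,\frac1{\mu(B(x,r))}\int_{B(x,r)}|v-v_{B(x,r)}|\,d\mu,\qquad v_B=\frac1{\mu(B)}\int_Bv\,d\mu .$$ **Theorem.** Let $u\in N^1X$. Suppose that $\bigl\|\sigma\chi_{\{v^\sharp_1>\sigma\}}\bigr\|_X\to0$ as $\sigma\to\infty$ for every truncation $v=\max\{\min\{u,\tau\},-\tau\}$, $\tau\in(0,\infty)$, of $u$ (the rate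 of convergence may depend on $\tau$); or suppose that $u\in L^1_{\mathrm{loc}}(P)$ and $\bigl\|\sigma\chi_{\{u^\sharp_1>\sigma\}}\bigr\|_X\to0$ as $\sigma\to\infty$. Then, for every $\varepsilon>0$, there is a Lipschitz function $u_\varepsilon:P\to\mathbb R$ with $u_\varepsilon\in N^1X$ and $\|u-u_\varepsilon\|_{N^1X}<\varepsilon$. -/

import Mathlib

open MeasureTheory Filter Topology Set
open scoped NNReal ENNReal

/-- `μ` is non-atomic: it has no atoms, an atom being a measurable set `A` of positive measure such
that every measurable `B ⊆ A` satisfies `μ B = 0` or `μ (A \ B) = 0`. -/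
def IsNonatomic {P : Type*} [MeasurableSpace P] (μ : Measure P) : Prop :=
  ∀ A : Set P, MeasurableSet A → 0 < μ A → ∃ B ⊆ A, MeasurableSet B ∧ 0 < μ B ∧ 0 < μ (A \ B)

/-- A quasi-Banach function lattice over `(P, μ)`, given by its quasi-norm
`‖·‖_X : M(P, μ) → [0, ∞]` on the extended real-valued `μ`-measurable functions, which are defined
everywhere (no identification almost everywhere). The quasi-norm determines the space:
`X = {u ∈ M(P, μ) : ‖u‖_X < ∞}`. Here "`μ`-measurable" means measurable with respect to
the completion of the underlying sigma-algebra, that is, `AEMeasurable`; values of `nrm` at functions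
that are not `μ`-measurable are never used. -/
structure QuasiBanachFunctionLattice {P : Type*} [MeasurableSpace P] (μ : Measure P) where
  /-- the quasi-norm -/
  nrm : (P → EReal) → ℝ≥0∞
  /-- the modulus of concavity -/
  c : ℝ≥0
  one_le_c : 1 ≤ c
  nrm_eq_zero_iff : ∀ u : P → EReal, AEMeasurable u μ → (nrm u = 0 ↔ u =ᵐ[μ] 0)
  nrm_smul : ∀ (a : ℝ) (u : P → EReal), AEMeasurable u μ →
    nrm (fun x => (a : EReal) * u x) = ENNReal.ofReal |a| * nrm u
  nrm_add_le : ∀ u v : P → EReal, AEMeasurable u μ → AEMeasurable v μ →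
    nrm (fun x => u x + v x) ≤ c * (nrm u + nrm v)
  /-- the lattice property -/
  nrm_mono : ∀ u v : P → EReal, AEMeasurable u μ → AEMeasurable v μ →
    (∀ᵐ x ∂μ, (u x).abs ≤ (v x).abs) → nrm u ≤ nrm v
  /-- the Riesz–Fischer property `‖∑ u_n‖ ≤ ∑ c ^ n ‖u_n‖`, `n = 1, 2, …`, for functions that are
  nonnegative a.e. (the sequence is indexed from `0` here) -/
  riesz_fischer : ∀ u : ℕ → P → EReal, (∀ n, AEMeasurable (u n) μ) →
    (∀ n, ∀ᵐ x ∂μ, 0 ≤ u n x) →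
    nrm (fun x => ((∑' n, (u n x).toENNReal : ℝ≥0∞) : EReal)) ≤
      ∑' n, (c : ℝ≥0∞) ^ (n + 1) * nrm (u n)
  /-- continuity of the quasi-norm -/
  nrm_continuous : ∀ (u : ℕ → P → EReal) (v : P → EReal), (∀ n, AEMeasurable (u n) μ) →
    AEMeasurable v μ → Tendsto (fun n => nrm (fun x => u n x - v x)) atTop (𝓝 0) →
    Tendsto (fun n => nrm (u n)) atTop (𝓝 (nrm v))

namespace QuasiBanachFunctionLattice

variable {P : Type*} [MeasurableSpace P] {μ : Measure P}

/-- Membership in `X`. -/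
def Mem (X : QuasiBanachFunctionLattice μ) (u : P → EReal) : Prop :=
  AEMeasurable u μ ∧ X.nrm u < ∞

/-- The quasi-norm of `X` is absolutely continuous. -/
def AbsolutelyContinuousNorm (X : QuasiBanachFunctionLattice μ) : Prop :=
  ∀ u : P → EReal, X.Mem u → ∀ E : ℕ → Set P, (∀ n, NullMeasurableSet (E n) μ) → Antitone E →
    μ (⋂ n, E n) = 0 → Tendsto (fun n => X.nrm ((E n).indicator u)) atTop (𝓝 0)

end QuasiBanachFunctionLattice

/-- A Borel function `g : P → [0, ∞]` is an upper gradient of `u` if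
`|u(γ(0)) - u(γ(l))| ≤ ∫_γ g ds` for every non-constant rectifiable curve `γ : [0, l] → P`
parametrized by arc length. In `EReal` one has `⊤ - ⊤ = ⊥ - ⊥ = ⊥`, so that
the convention `|(±∞) - (±∞)| = ∞` is in force. -/
def IsUpperGradient {P : Type*} [PseudoEMetricSpace P] [MeasurableSpace P]
    (u : P → EReal) (g : P → ℝ≥0∞) : Prop :=
  Measurable g ∧ ∀ (l : ℝ) (γ : ℝ → P), 0 < l → HasUnitSpeedOn γ (Icc 0 l) →
    (u (γ 0) - u (γ l)).abs ≤ ∫⁻ t in Icc 0 l, g (γ t)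

namespace QuasiBanachFunctionLattice

variable {P : Type*} [PseudoEMetricSpace P] [MeasurableSpace P] {μ : Measure P}

/-- The Newtonian quasi-seminorm `‖u‖_{N¹X} = ‖u‖_X + inf_g ‖g‖_X`, the infimum being taken over
all upper gradients `g` of `u`. -/
noncomputable def newtonNorm (X : QuasiBanachFunctionLattice μ) (u : P → EReal) : ℝ≥0∞ :=
  X.nrm u + ⨅ (g : P → ℝ≥0∞) (_ : IsUpperGradient u g), X.nrm (fun x => (g x : EReal))

/-- Membership in the Newtonian space `N¹X`. -/
def MemNewton (X : QuasiBanachFunctionLattice μ) (u : P → EReal) : Prop :=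
  AEMeasurable u μ ∧ X.newtonNorm u < ∞

end QuasiBanachFunctionLattice

/-- The truncation of `u` at the levels `±τ`. -/
noncomputable def truncation {P : Type*} (u : P → EReal) (τ : ℝ) : P → EReal :=
  fun x => max (min (u x) (τ : EReal)) (-(τ : EReal))

/-- `u ∈ L¹_loc`: `u` is integrable over every ball. -/
def LocIntegrableOnBalls {P : Type*} [PseudoMetricSpace P] [MeasurableSpace P]
    (μ : Measure P) (u : P → EReal) : Prop :=
  AEMeasurable u μ ∧ ∀ (x : P) (r : ℝ), ∫⁻ y in Metric.ball x r, (u y).abs ∂μ < ∞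

/-- The fractional sharp maximal function
`u^♯_1(x) = sup_{r > 0} (1 / r) ⨍_{B(x, r)} |u - u_{B(x, r)}| dμ` of `u ∈ L¹_loc`. Such a function is
finite a.e., and the integral mean `u_{B(x, r)}` is the mean of its real part. -/
noncomputable def fracSharp {P : Type*} [PseudoMetricSpace P] [MeasurableSpace P]
    (μ : Measure P) (u : P → EReal) (x : P) : ℝ≥0∞ :=
  ⨆ (r : ℝ) (_ : 0 < r), (ENNReal.ofReal r)⁻¹ *
    ⨍⁻ y in Metric.ball x r,
      (u y - ((⨍ z in Metric.ball x r, (u z).toReal ∂μ : ℝ) : EReal)).abs ∂μ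

/-- The weak estimate `‖σ χ_{u^♯_1 > σ}‖_X → 0` as `σ → ∞`. -/
def SharpWeakEstimate {P : Type*} [PseudoMetricSpace P] [MeasurableSpace P] {μ : Measure P}
    (X : QuasiBanachFunctionLattice μ) (u : P → EReal) : Prop :=
  Tendsto (fun σ : ℝ => X.nrm
    ({x | ENNReal.ofReal σ < fracSharp μ u x}.indicator (fun _ => (σ : EReal)))) atTop (𝓝 0)

/-! Two approximations are composed: `u` by a truncation, and the truncation by a Lipschitz
function. In both the error vanishes off a set `E` that shrinks to a null set, and its upper
gradient has to be localized to `E`.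

The localization is `IsUpperGradient.indicator_add`. Let the error have upper gradient `g + K` and
vanish off a Borel set `F`. Along a curve with `∫ g < ∞` the error is finite and continuous, so up
to its first zero and after its last zero the curve stays in `F`, and in between nothing has to be
paid. Curves with `∫ g = ∞` are absorbed by adding `δ g`, for any `δ > 0`. Hence `(g + K) χ_F + δ g`
is an upper gradient. Null sets may be added to `F` without changing the norm, and no exceptional
families of curves are needed.

For the truncation, `E = {|u| > n}` and `K = 0`. Since `n χ_E ≤ |u|`, the norms of `χ_E` tend to
zero, the sets shrink to a null set, and absolute continuity finishes (`exists_truncation_approx`).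

For bounded `f`, telescoping averages over shrinking balls shows that `f` is Lipschitz with constant
`D σ` on the Lebesgue points where `f^♯ ≤ σ` (`IsBallLebesguePoint.abs_sub_le_mul_dist`). A McShane
extension `w`, clamped at the bound of `f`, agrees with `f` off `{f^♯ > σ}` and a null set, and `f -
w` has upper gradient `g + D σ`. After localization the dangerous term is `D σ ‖χ_{f^♯ > σ}‖`,
exactly what the weak estimate makes small (`exists_lipschitz_approx`).

An estimate for `u` itself passes to truncations because truncating at most doubles the mean
oscillation over a ball. -/

/-! ### Absolute values and differences of extended reals -/

theorem EReal.measurable_abs : Measurable EReal.abs :=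
  EReal.measurable_of_measurable_real
    (show Measurable fun x : ℝ => ENNReal.ofReal |x| by fun_prop)

theorem EReal.abs_coe_ennreal (a : ℝ≥0∞) : (a : EReal).abs = a := by
  induction a using ENNReal.recTopCoe with
  | top => rfl
  | coe a =>
    change ((a : ℝ) : EReal).abs = a
    rw [EReal.abs_def, NNReal.abs_eq, ENNReal.ofReal_coe_nnreal]

theorem EReal.abs_coe_sub_coe (a b : ℝ) :
    ((a : EReal) - (b : EReal)).abs = ENNReal.ofReal |a - b| := by
  rw [← EReal.coe_sub, EReal.abs_def]

theorem EReal.exists_coe_eq_of_abs_lt_top {x : EReal} (h : x.abs < ∞) : ∃ a : ℝ, x = a := by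
  induction x with
  | bot => simp at h
  | top => simp at h
  | coe a => exact ⟨a, rfl⟩

theorem EReal.exists_coe_of_abs_sub_lt_top {x y : EReal} (h : (x - y).abs < ∞) :
    ∃ a b : ℝ, x = a ∧ y = b := by
  induction x <;> induction y <;> first | exact ⟨_, _, rfl, rfl⟩ | (simp at h)

theorem EReal.abs_sub_comm (x y : EReal) : (x - y).abs = (y - x).abs := by
  by_cases h : (x - y).abs < ∞
  · obtain ⟨a, b, rfl, rfl⟩ := EReal.exists_coe_of_abs_sub_lt_top h
    rw [EReal.abs_coe_sub_coe, EReal.abs_coe_sub_coe, _root_.abs_sub_comm]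
  · by_cases h' : (y - x).abs < ∞
    · obtain ⟨a, b, rfl, rfl⟩ := EReal.exists_coe_of_abs_sub_lt_top h'
      rw [EReal.abs_coe_sub_coe, EReal.abs_coe_sub_coe, _root_.abs_sub_comm]
    · rw [not_lt_top_iff.1 h, not_lt_top_iff.1 h']

theorem AEMeasurable.ereal_abs {P : Type*} [MeasurableSpace P] {μ : Measure P} {u : P → EReal}
    (hu : AEMeasurable u μ) : AEMeasurable (fun x => (u x).abs) μ :=
  EReal.measurable_abs.comp_aemeasurable hu

/-! ### The quasi-norm on nonnegative functions -/

namespace QuasiBanachFunctionLattice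

variable {P : Type*} [MeasurableSpace P] {μ : Measure P}

/-- The quasi-norm of a nonnegative function. -/
noncomputable def enrm (X : QuasiBanachFunctionLattice μ) (h : P → ℝ≥0∞) : ℝ≥0∞ :=
  X.nrm (fun x => (h x : EReal))

variable (X : QuasiBanachFunctionLattice μ)

theorem enrm_mono {h k : P → ℝ≥0∞} (hh : AEMeasurable h μ) (hk : AEMeasurable k μ)
    (hle : ∀ᵐ x ∂μ, h x ≤ k x) : X.enrm h ≤ X.enrm k :=
  X.nrm_mono _ _ hh.coe_ereal_ennreal hk.coe_ereal_ennreal <| by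
    simpa only [EReal.abs_coe_ennreal] using hle

theorem nrm_eq_enrm_abs {u : P → EReal} (hu : AEMeasurable u μ) :
    X.nrm u = X.enrm (fun x => (u x).abs) :=
  le_antisymm
    (X.nrm_mono _ _ hu hu.ereal_abs.coe_ereal_ennreal (by simp [EReal.abs_coe_ennreal]))
    (X.nrm_mono _ _ hu.ereal_abs.coe_ereal_ennreal hu (by simp [EReal.abs_coe_ennreal]))

theorem enrm_add_le {h k : P → ℝ≥0∞} (hh : AEMeasurable h μ) (hk : AEMeasurable k μ) :
    X.enrm (fun x => h x + k x) ≤ X.c * (X.enrm h + X.enrm k) := by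
  have := X.nrm_add_le _ _ hh.coe_ereal_ennreal hk.coe_ereal_ennreal
  simpa only [enrm, EReal.coe_ennreal_add] using this

theorem enrm_const_mul (a : ℝ≥0) {h : P → ℝ≥0∞} (hh : AEMeasurable h μ) :
    X.enrm (fun x => a * h x) = a * X.enrm h := by
  have := X.nrm_smul a _ hh.coe_ereal_ennreal
  rw [NNReal.abs_eq, ENNReal.ofReal_coe_nnreal] at this
  rw [enrm, enrm, ← this]
  congr 1
  funext x
  rw [EReal.coe_ennreal_mul]
  rfl

theorem enrm_zero_iff {h : P → ℝ≥0∞} (hh : AEMeasurable h μ) : X.enrm h = 0 ↔ h =ᵐ[μ] 0 := by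
  rw [enrm, X.nrm_eq_zero_iff _ hh.coe_ereal_ennreal]
  simp only [EventuallyEq, Pi.zero_apply, EReal.coe_ennreal_eq_zero]

theorem nrm_add_le_of_abs_le {u v w : P → EReal} (hu : AEMeasurable u μ) (hv : AEMeasurable v μ)
    (hw : AEMeasurable w μ) (h : ∀ᵐ x ∂μ, (w x).abs ≤ (u x).abs + (v x).abs) :
    X.nrm w ≤ X.c * (X.nrm u + X.nrm v) := by
  rw [X.nrm_eq_enrm_abs hu, X.nrm_eq_enrm_abs hv, X.nrm_eq_enrm_abs hw]
  exact (X.enrm_mono hw.ereal_abs (hu.ereal_abs.add hv.ereal_abs) h).trans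
    (X.enrm_add_le hu.ereal_abs hv.ereal_abs)

/-- Absolute continuity of the quasi-norm for nonnegative functions. -/
theorem AbsolutelyContinuousNorm.tendsto_enrm_indicator {X : QuasiBanachFunctionLattice μ}
    (hX : X.AbsolutelyContinuousNorm) {h : P → ℝ≥0∞} (hh : AEMeasurable h μ)
    (hfin : X.enrm h < ∞) {E : ℕ → Set P} (hE : ∀ n, NullMeasurableSet (E n) μ)
    (hanti : Antitone E) (hnull : μ (⋂ n, E n) = 0) :
    Tendsto (fun n => X.enrm ((E n).indicator h)) atTop (𝓝 0) := by
  convert hX _ ⟨hh.coe_ereal_ennreal, hfin⟩ E hE hanti hnull using 3 with n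
  rw [enrm]
  congr 1
  funext x
  by_cases hx : x ∈ E n <;> simp [hx]

/-- If a multiple of the indicators of the sets `E n` tends to zero in norm while the factors stay
at least `1`, then the intersection is a null set. -/
theorem measure_iInter_eq_zero_of_tendsto {E : ℕ → Set P} (hE : ∀ n, NullMeasurableSet (E n) μ)
    (h : Tendsto (fun n => X.enrm ((E n).indicator 1)) atTop (𝓝 0)) : μ (⋂ n, E n) = 0 := by
  have hI : NullMeasurableSet (⋂ n, E n) μ := NullMeasurableSet.iInter hE
  have hm : ∀ {s : Set P}, NullMeasurableSet s μ → AEMeasurable (s.indicator (1 : P → ℝ≥0∞)) μ :=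
    fun hs => aemeasurable_one.indicator₀ hs
  have h0 : X.enrm ((⋂ n, E n).indicator 1) = 0 := by
    refine le_antisymm (ge_of_tendsto' h fun n => X.enrm_mono (hm hI) (hm (hE n)) ?_) bot_le
    exact ae_of_all _ fun x => indicator_le_indicator_of_subset (iInter_subset _ n)
      (fun _ => zero_le) x
  rw [X.enrm_zero_iff (hm hI)] at h0
  rw [measure_eq_zero_iff_ae_notMem]
  filter_upwards [h0] with x hx hmem
  simp [indicator_of_mem hmem] at hx

/-- The norm of the upper gradient localized to a Borel set. -/
theorem enrm_indicator_add_le {K δ : ℝ≥0} {g : P → ℝ≥0∞} (hg : Measurable g) {E F : Set P}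
    (hF : MeasurableSet F) (hEF : F =ᵐ[μ] E) :
    X.enrm (fun x => F.indicator (fun x => g x + K) x + δ * g x) ≤
      X.c * (X.c * (X.enrm (E.indicator g) + K * X.enrm (E.indicator 1)) + δ * X.enrm g) := by
  have h1 : AEMeasurable (F.indicator g) μ := (hg.indicator hF).aemeasurable
  have h2 : AEMeasurable (F.indicator (1 : P → ℝ≥0∞)) μ := (measurable_one.indicator hF).aemeasurable
  have hE : NullMeasurableSet E μ := hF.nullMeasurableSet.congr hEF
  have h1' : AEMeasurable (E.indicator g) μ := hg.aemeasurable.indicator₀ hE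
  have h2' : AEMeasurable (E.indicator (1 : P → ℝ≥0∞)) μ := aemeasurable_one.indicator₀ hE
  refine (X.enrm_add_le ((hg.add_const _).indicator hF).aemeasurable
    (hg.const_mul _).aemeasurable).trans (mul_le_mul_right (add_le_add ?_ ?_) _)
  · have heq : F.indicator (fun x => g x + K) =
        fun x => F.indicator g x + K * F.indicator (1 : P → ℝ≥0∞) x := by
      funext x
      by_cases hx : x ∈ F <;> simp [hx]
    rw [heq]
    refine (X.enrm_add_le h1 (h2.const_mul _)).trans (mul_le_mul_right (add_le_add ?_ ?_) _)
    · exact X.enrm_mono h1 h1' (indicator_ae_eq_of_ae_eq_set hEF).le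
    · rw [X.enrm_const_mul K h2]
      exact mul_le_mul_right (X.enrm_mono h2 h2' (indicator_ae_eq_of_ae_eq_set hEF).le) _
  · rw [X.enrm_const_mul δ hg.aemeasurable]

end QuasiBanachFunctionLattice

/-! ### Upper gradients along curves and their localization -/

/-- If the increments of `φ` on `[0, l]` are controlled by the integral of `G`, then the zeros of
`φ` do not contribute to the increment over the whole interval. -/
theorem ofReal_abs_sub_le_setLIntegral_support {φ : ℝ → ℝ} {G H : ℝ → ℝ≥0∞} {l : ℝ} (hl : 0 ≤ l)
    (hfin : ∫⁻ t in Icc 0 l, G t ≠ ∞)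
    (h : ∀ a b, 0 ≤ a → a ≤ b → b ≤ l → ENNReal.ofReal |φ a - φ b| ≤ ∫⁻ t in Icc a b, G t)
    (hH : ∀ t ∈ Icc 0 l, φ t ≠ 0 → G t ≤ H t) :
    ENNReal.ofReal |φ 0 - φ l| ≤ ∫⁻ t in Icc 0 l, H t := by
  -- Absolute continuity of the integral of `G` makes `φ` continuous, so its zero set is compact and
  -- has a first and a last point.
  have hcont : ContinuousOn φ (Icc 0 l) := by
    intro t ht
    rw [ContinuousWithinAt, tendsto_iff_edist_tendsto_0, ENNReal.tendsto_nhds_zero]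
    intro ε hε
    obtain ⟨δ, hδ, hδ'⟩ := exists_pos_setLIntegral_lt_of_measure_lt hfin hε.ne'
    obtain ⟨δ₁, hδ₁, hδ₁'⟩ := ENNReal.lt_iff_exists_nnreal_btwn.1 hδ
    have hnear : ∀ᶠ s in 𝓝[Icc 0 l] t, |s - t| < δ₁ := by
      refine nhdsWithin_le_nhds ?_
      have := Metric.ball_mem_nhds t (NNReal.coe_pos.2 (ENNReal.coe_pos.1 hδ₁))
      filter_upwards [this] with s hs using by simpa [Real.dist_eq] using hs
    filter_upwards [hnear, self_mem_nhdsWithin] with s hs hsl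
    have key : ∀ a b, 0 ≤ a → a ≤ b → b ≤ l → b - a < δ₁ →
        ENNReal.ofReal |φ a - φ b| ≤ ε := by
      intro a b ha hab hb hlt
      refine (h a b ha hab hb).trans ?_
      have := hδ' (Icc a b) ((Measure.restrict_apply_le _ _).trans_lt ?_)
      · rw [Measure.restrict_restrict measurableSet_Icc,
          inter_eq_left.2 (Icc_subset_Icc ha hb)] at this
        exact this.le
      · rw [Real.volume_Icc]
        refine lt_of_le_of_lt ?_ hδ₁'
        rw [← ENNReal.ofReal_coe_nnreal]
        exact ENNReal.ofReal_le_ofReal hlt.le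
    rw [edist_dist, Real.dist_eq]
    rcases le_total s t with hst | hst
    · exact key s t hsl.1 hst ht.2 (by rw [abs_lt] at hs; linarith)
    · rw [abs_sub_comm]
      exact key t s ht.1 hst hsl.2 (by rw [abs_lt] at hs; linarith)
  by_cases hz : ∃ t ∈ Icc 0 l, φ t = 0
  · let Z := {t ∈ Icc 0 l | φ t = 0}
    have hZc : IsCompact Z := by
      have : Z = Icc 0 l ∩ φ ⁻¹' {0} := rfl
      rw [this]
      exact isCompact_Icc.of_isClosed_subset
        (hcont.preimage_isClosed_of_isClosed isClosed_Icc isClosed_singleton) inter_subset_left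
    have hZn : Z.Nonempty := hz
    obtain ⟨a, haZ, ha⟩ := hZc.exists_isLeast hZn
    obtain ⟨b, hbZ, hb⟩ := hZc.exists_isGreatest hZn
    have hab : a ≤ b := ha hbZ
    -- The zero `a` itself is dropped from the interval, since `G ≤ H` is known only where `φ ≠ 0`;
    -- the same holds for `b` below.
    have h1 : ENNReal.ofReal |φ 0| ≤ ∫⁻ t in Ico 0 a, G t := by
      have := h 0 a le_rfl haZ.1.1 haZ.1.2
      rwa [haZ.2, sub_zero, ← setLIntegral_congr Ico_ae_eq_Icc] at this
    have h2 : ENNReal.ofReal |φ l| ≤ ∫⁻ t in Ioc b l, G t := by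
      have := h b l hbZ.1.1 hbZ.1.2 le_rfl
      rwa [hbZ.2, zero_sub, abs_neg, ← setLIntegral_congr Ioc_ae_eq_Icc] at this
    calc ENNReal.ofReal |φ 0 - φ l|
        ≤ ENNReal.ofReal (|φ 0| + |φ l|) := ENNReal.ofReal_le_ofReal (abs_sub _ _)
      _ = ENNReal.ofReal |φ 0| + ENNReal.ofReal |φ l| :=
          ENNReal.ofReal_add (abs_nonneg _) (abs_nonneg _)
      _ ≤ (∫⁻ t in Ico 0 a, G t) + ∫⁻ t in Ioc b l, G t := add_le_add h1 h2
      _ = ∫⁻ t in Ico 0 a ∪ Ioc b l, G t := by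
          rw [lintegral_union measurableSet_Ioc]
          rw [Set.disjoint_left]
          intro t ht ht'
          exact absurd (ht.2.trans_le hab) (not_lt.2 ht'.1.le)
      _ ≤ ∫⁻ t in Ico 0 a ∪ Ioc b l, H t := by
          refine setLIntegral_mono' (measurableSet_Ico.union measurableSet_Ioc) ?_
          rintro t (ht | ht)
          · have htl : t ∈ Icc 0 l := ⟨ht.1, ht.2.le.trans haZ.1.2⟩
            exact hH t htl fun h0 => absurd (ha ⟨htl, h0⟩) (not_le.2 ht.2)
          · have htl : t ∈ Icc 0 l := ⟨hbZ.1.1.trans ht.1.le, ht.2⟩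
            exact hH t htl fun h0 => absurd (hb ⟨htl, h0⟩) (not_le.2 ht.1)
      _ ≤ ∫⁻ t in Icc 0 l, H t := by
          refine lintegral_mono_set (union_subset ?_ ?_)
          · exact Ico_subset_Icc_self.trans (Icc_subset_Icc le_rfl haZ.1.2)
          · exact Ioc_subset_Icc_self.trans (Icc_subset_Icc hbZ.1.1 le_rfl)
  · push Not at hz
    exact (h 0 l le_rfl hl le_rfl).trans
      (setLIntegral_mono' measurableSet_Icc fun t ht => hH t ht (hz t ht))

theorem HasUnitSpeedOn.comp_const_add {E : Type*} [PseudoEMetricSpace E] {γ : ℝ → E} {l a b : ℝ}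
    (h : HasUnitSpeedOn γ (Icc 0 l)) (ha : 0 ≤ a) (hb : b ≤ l) :
    HasUnitSpeedOn (fun t => γ (a + t)) (Icc 0 (b - a)) := by
  intro x hx y hy
  have hsub : Icc x y ⊆ Icc 0 (b - a) := Icc_subset_Icc hx.1 hy.2
  have hsub' : Icc (a + x) (a + y) ⊆ Icc 0 l :=
    Icc_subset_Icc (by linarith [hx.1]) (by linarith [hy.2])
  have h1 := eVariationOn.comp_eq_of_monotoneOn γ (t := Icc x y) (fun t => a + t)
    (fun s _ t _ hst => by simpa using hst)
  have h2 := h (x := a + x) ⟨by linarith [hx.1], by linarith [hx.2]⟩ (y := a + y)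
    ⟨by linarith [hy.1], by linarith [hy.2]⟩
  rw [inter_eq_right.2 hsub'] at h2
  rw [inter_eq_right.2 hsub]
  rw [image_const_add_Icc, h2] at h1
  refine h1.trans ?_
  congr 2
  ring

theorem HasUnitSpeedOn.edist_le {E : Type*} [PseudoEMetricSpace E] {γ : ℝ → E} {l : ℝ}
    (h : HasUnitSpeedOn γ (Icc 0 l)) (hl : 0 ≤ l) : edist (γ 0) (γ l) ≤ ENNReal.ofReal l := by
  have h0 : (0 : ℝ) ∈ Icc 0 l := ⟨le_rfl, hl⟩
  have h1 : l ∈ Icc 0 l := ⟨hl, le_rfl⟩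
  have := h h0 h1
  rw [inter_self, NNReal.coe_one, one_mul, sub_zero] at this
  exact this ▸ eVariationOn.edist_le γ h0 h1

namespace IsUpperGradient

variable {P : Type*} [PseudoEMetricSpace P] [MeasurableSpace P] {u v : P → EReal}
  {g h : P → ℝ≥0∞}

/-- A sub-arc, translated to start at time zero, is again parametrized by arc length, so the
defining inequality applies to it. -/
theorem abs_sub_le_setLIntegral_Icc (hg : IsUpperGradient u g) {γ : ℝ → P} {l a b : ℝ}
    (hγ : HasUnitSpeedOn γ (Icc 0 l)) (ha : 0 ≤ a) (hab : a < b) (hb : b ≤ l) :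
    (u (γ a) - u (γ b)).abs ≤ ∫⁻ t in Icc a b, g (γ t) := by
  have := hg.2 (b - a) (fun t => γ (a + t)) (sub_pos.2 hab) (hγ.comp_const_add ha hb)
  simp only [add_zero, add_sub_cancel] at this
  refine this.trans_eq ?_
  rw [← lintegral_indicator measurableSet_Icc, ← lintegral_indicator measurableSet_Icc,
    ← lintegral_add_left_eq_self ((Icc a b).indicator fun t => g (γ t)) a]
  congr 1
  funext t
  simp only [indicator, mem_Icc]
  congr 1
  simp only [eq_iff_iff]
  constructor <;> rintro ⟨h1, h2⟩ <;> constructor <;> linarith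

theorem mono_abs_sub (hg : IsUpperGradient u g)
    (huv : ∀ x y, (v x - v y).abs ≤ (u x - u y).abs) : IsUpperGradient v g :=
  ⟨hg.1, fun l γ hl hγ => (huv _ _).trans (hg.2 l γ hl hγ)⟩

/-- An upper gradient may be restricted to a Borel set off which the function vanishes, up to
adding a small multiple of it that controls the exceptional curves. -/
theorem indicator_add {K δ : ℝ≥0} (hδ : 0 < δ) (hg : Measurable g)
    (hu : IsUpperGradient u (fun x => g x + K)) {F : Set P} (hF : MeasurableSet F)
    (hzero : ∀ x ∉ F, u x = 0) :
    IsUpperGradient u (fun x => F.indicator (fun x => g x + K) x + δ * g x) := by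
  refine ⟨(hu.1.indicator hF).add (hg.const_mul _), fun l γ hl hγ => ?_⟩
  -- If `g` is not integrable along the curve, the term `δ * g` alone makes the right-hand side
  -- infinite.
  by_cases hfin : ∫⁻ t in Icc 0 l, g (γ t) = ∞
  · refine le_top.trans ?_
    have : ∫⁻ t in Icc 0 l, (δ : ℝ≥0∞) * g (γ t) = ∞ := by
      rw [lintegral_const_mul' _ _ ENNReal.coe_ne_top, hfin,
        ENNReal.mul_top (by simpa using hδ.ne')]
    rw [← this]
    exact lintegral_mono fun t => le_add_self
  · have hfin' : ∫⁻ t in Icc 0 l, (g (γ t) + K) ≠ ∞ := by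
      rw [lintegral_add_right _ measurable_const, setLIntegral_const, Real.volume_Icc]
      exact ENNReal.add_ne_top.2 ⟨hfin, ENNReal.mul_ne_top ENNReal.coe_ne_top
        ENNReal.ofReal_ne_top⟩
    have hsub : ∀ a b, 0 ≤ a → a < b → b ≤ l →
        (u (γ a) - u (γ b)).abs ≤ ∫⁻ t in Icc a b, (g (γ t) + K) :=
      fun a b ha hab hb => hu.abs_sub_le_setLIntegral_Icc hγ ha hab hb
    have hlt : ∀ a b, 0 ≤ a → a < b → b ≤ l → (u (γ a) - u (γ b)).abs < ∞ :=
      fun a b ha hab hb => (hsub a b ha hab hb).trans_lt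
        ((lintegral_mono_set (Icc_subset_Icc ha hb)).trans_lt hfin'.lt_top)
    -- A finite difference forces both values to be real, since infinite values have infinite
    -- difference. Each point is compared with the endpoint `l`, and `l` with `0`.
    have hreal : ∀ t ∈ Icc 0 l, ((u (γ t)).toReal : EReal) = u (γ t) := by
      intro t ht
      rcases ht.2.lt_or_eq with h | h
      · obtain ⟨a, b, h1, -⟩ := EReal.exists_coe_of_abs_sub_lt_top (hlt t l ht.1 h le_rfl)
        rw [h1, EReal.toReal_coe]
      · obtain ⟨a, b, -, h1⟩ := EReal.exists_coe_of_abs_sub_lt_top (hlt 0 l le_rfl hl le_rfl)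
        rw [h, h1, EReal.toReal_coe]
    have h0 : (0 : ℝ) ∈ Icc 0 l := ⟨le_rfl, hl.le⟩
    have hl' : l ∈ Icc 0 l := ⟨hl.le, le_rfl⟩
    rw [← hreal 0 h0, ← hreal l hl', EReal.abs_coe_sub_coe]
    refine ofReal_abs_sub_le_setLIntegral_support (φ := fun t => (u (γ t)).toReal)
      (G := fun t => g (γ t) + K) hl.le hfin' ?_ ?_
    · intro a b ha hab hb
      rcases hab.lt_or_eq with h | h
      · rw [← EReal.abs_coe_sub_coe, hreal a ⟨ha, hab.trans hb⟩, hreal b ⟨ha.trans hab, hb⟩]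
        exact hsub a b ha h hb
      · simp [h]
    · intro t ht hne
      have : γ t ∈ F := by
        by_contra hmem
        exact hne (by simp [hzero _ hmem])
      simp only [indicator_of_mem this]
      exact le_self_add

theorem add (hu : IsUpperGradient u g) (hv : IsUpperGradient v h) {w : P → EReal}
    (hw : ∀ x y, (w x - w y).abs ≤ (u x - u y).abs + (v x - v y).abs) :
    IsUpperGradient w (fun x => g x + h x) :=
  ⟨hu.1.add hv.1, fun l γ hl hγ => (hw _ _).trans <|
    (add_le_add (hu.2 l γ hl hγ) (hv.2 l γ hl hγ)).trans (le_lintegral_add _ _)⟩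

theorem of_lipschitzWith {w : P → ℝ} {K : ℝ≥0} (hw : LipschitzWith K w) :
    IsUpperGradient (fun x => (w x : EReal)) (fun _ => (K : ℝ≥0∞)) := by
  refine ⟨measurable_const, fun l γ hl hγ => ?_⟩
  rw [EReal.abs_coe_sub_coe, ← Real.dist_eq, ← edist_dist, setLIntegral_const, Real.volume_Icc,
    sub_zero]
  exact (hw _ _).trans (mul_le_mul_right (hγ.edist_le hl.le) _)

end IsUpperGradient

/-! ### Averages and mean oscillation -/

theorem ENNReal.ofReal_abs_add_le (a b : ℝ) :
    ENNReal.ofReal |a + b| ≤ ENNReal.ofReal |a| + ENNReal.ofReal |b| := by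
  rw [← ENNReal.ofReal_add (abs_nonneg _) (abs_nonneg _)]
  exact ENNReal.ofReal_le_ofReal (abs_add_le a b)

section Average

variable {α : Type*} [MeasurableSpace α] {μ : Measure α} {f : α → ℝ}

theorem ofReal_abs_average_sub_le [IsFiniteMeasure μ] [NeZero μ] (hf : Integrable f μ) (a : ℝ) :
    ENNReal.ofReal |(⨍ y, f y ∂μ) - a| ≤ ⨍⁻ y, ENNReal.ofReal |f y - a| ∂μ := by
  have h := enorm_integral_le_lintegral_enorm (μ := (μ univ)⁻¹ • μ) (fun y => f y - a)
  have hf' : Integrable f ((μ univ)⁻¹ • μ) := hf.to_average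
  rw [integral_sub hf' (integrable_const a), integral_const, probReal_univ, one_smul] at h
  simp only [Real.enorm_eq_ofReal_abs] at h
  exact h

theorem ofReal_abs_setAverage_sub_le {s : Set α} (h0 : μ s ≠ 0) (hfin : μ s ≠ ∞)
    (hf : IntegrableOn f s μ) (a : ℝ) :
    ENNReal.ofReal |(⨍ y in s, f y ∂μ) - a| ≤ ⨍⁻ y in s, ENNReal.ofReal |f y - a| ∂μ := by
  have : IsFiniteMeasure (μ.restrict s) := ⟨by simpa using hfin.lt_top⟩
  have : NeZero (μ.restrict s) := ⟨by simpa [Measure.restrict_eq_zero] using h0⟩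
  exact ofReal_abs_average_sub_le hf a

/-- The mean oscillation of a `1`-Lipschitz image is at most twice the mean oscillation. -/
theorem laverage_comp_sub_average_le {s : Set α} (h0 : μ s ≠ 0) (hfin : μ s ≠ ∞)
    (hf : IntegrableOn f s μ) {φ : ℝ → ℝ} (hφ : LipschitzWith 1 φ) :
    ⨍⁻ y in s, ENNReal.ofReal |φ (f y) - ⨍ z in s, φ (f z) ∂μ| ∂μ ≤
      2 * ⨍⁻ y in s, ENNReal.ofReal |f y - ⨍ z in s, f z ∂μ| ∂μ := by
  have : IsFiniteMeasure (μ.restrict s) := ⟨by simpa using hfin.lt_top⟩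
  have : NeZero (μ.restrict s) := ⟨by simpa [Measure.restrict_eq_zero] using h0⟩
  set m := ⨍ z in s, f z ∂μ
  have hφ' : ∀ a b, ENNReal.ofReal |φ a - φ b| ≤ ENNReal.ofReal |a - b| := fun a b => by
    have := hφ a b
    rwa [ENNReal.coe_one, one_mul, edist_dist, edist_dist, Real.dist_eq, Real.dist_eq] at this
  have hφf : IntegrableOn (fun y => φ (f y)) s μ := by
    have h1 : IntegrableOn (fun y => |φ 0| + |f y|) s μ := (integrable_const _).add hf.abs
    refine Integrable.mono' h1 (hφ.continuous.comp_aestronglyMeasurable hf.1) ?_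
    refine ae_of_all _ fun y => ?_
    have := hφ.dist_le_mul (f y) 0
    rw [Real.dist_eq, Real.dist_eq, NNReal.coe_one, one_mul, sub_zero] at this
    rw [Real.norm_eq_abs]
    have h2 := abs_add_le (φ (f y) - φ 0) (φ 0)
    rw [sub_add_cancel] at h2
    linarith
  -- Oscillation is first measured around `φ m`; replacing `φ m` by the true mean of `φ ∘ f` costs
  -- the same amount once more, hence the factor `2`.
  have hbase : ⨍⁻ y in s, ENNReal.ofReal |φ (f y) - φ m| ∂μ ≤
      ⨍⁻ y in s, ENNReal.ofReal |f y - m| ∂μ := by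
    rw [laverage_eq', laverage_eq']
    exact lintegral_mono fun y => hφ' _ _
  calc ⨍⁻ y in s, ENNReal.ofReal |φ (f y) - ⨍ z in s, φ (f z) ∂μ| ∂μ
      ≤ ⨍⁻ y in s, (ENNReal.ofReal |φ (f y) - φ m| +
          ENNReal.ofReal |φ m - ⨍ z in s, φ (f z) ∂μ|) ∂μ := by
        rw [laverage_eq', laverage_eq']
        refine lintegral_mono fun y => ?_
        have := ENNReal.ofReal_abs_add_le (φ (f y) - φ m) (φ m - ⨍ z in s, φ (f z) ∂μ)
        rwa [sub_add_sub_cancel] at this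
    _ = (⨍⁻ y in s, ENNReal.ofReal |φ (f y) - φ m| ∂μ) +
          ENNReal.ofReal |φ m - ⨍ z in s, φ (f z) ∂μ| := by
        rw [laverage_eq', laverage_eq', lintegral_add_right _ measurable_const,
          lintegral_const, measure_univ (μ := (μ.restrict s univ)⁻¹ • μ.restrict s), mul_one]
    _ ≤ (⨍⁻ y in s, ENNReal.ofReal |f y - m| ∂μ) + ⨍⁻ y in s, ENNReal.ofReal |f y - m| ∂μ := by
        refine add_le_add hbase ?_
        rw [abs_sub_comm]
        exact (ofReal_abs_average_sub_le hφf (φ m)).trans hbase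
    _ = 2 * ⨍⁻ y in s, ENNReal.ofReal |f y - m| ∂μ := (two_mul _).symm

theorem setLAverage_le_mul_of_subset {s t : Set α} (hst : s ⊆ t) (h0 : μ s ≠ 0)
    (hfin : μ t ≠ ∞) {D : ℝ≥0∞} (hD : μ t ≤ D * μ s) (h : α → ℝ≥0∞) :
    ⨍⁻ y in s, h y ∂μ ≤ D * ⨍⁻ y in t, h y ∂μ := by
  have ht0 : μ t ≠ 0 := fun h => h0 (measure_mono_null hst h)
  have hsfin : μ s ≠ ∞ := ne_top_of_le_ne_top hfin (measure_mono hst)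
  have hinv : (μ s)⁻¹ ≤ D * (μ t)⁻¹ :=
    calc (μ s)⁻¹ = (μ s)⁻¹ * (μ t * (μ t)⁻¹) := by rw [ENNReal.mul_inv_cancel ht0 hfin, mul_one]
      _ ≤ (μ s)⁻¹ * (D * μ s * (μ t)⁻¹) := by gcongr
      _ = ((μ s)⁻¹ * μ s) * (D * (μ t)⁻¹) := by ring
      _ = D * (μ t)⁻¹ := by rw [ENNReal.inv_mul_cancel h0 hsfin, one_mul]
  rw [setLAverage_eq, setLAverage_eq, div_eq_mul_inv, div_eq_mul_inv]
  calc (∫⁻ y in s, h y ∂μ) * (μ s)⁻¹ ≤ (∫⁻ y in t, h y ∂μ) * (D * (μ t)⁻¹) :=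
        mul_le_mul' (lintegral_mono_set hst) hinv
    _ = _ := by ring

end Average

/-! ### The fractional sharp maximal function and Lipschitz estimates -/

section FracSharp

variable {P : Type*} [PseudoMetricSpace P] [MeasurableSpace P] {μ : Measure P}

theorem fracSharp_congr {u v : P → EReal} (h : u =ᵐ[μ] v) : fracSharp μ u = fracSharp μ v := by
  funext x
  rw [fracSharp, fracSharp]
  refine iSup_congr fun r => iSup_congr fun _ => ?_
  have h1 : ⨍ z in Metric.ball x r, (u z).toReal ∂μ = ⨍ z in Metric.ball x r, (v z).toReal ∂μ :=
    average_congr (by filter_upwards [ae_restrict_of_ae h] with y hy using by rw [hy])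
  rw [h1]
  congr 1
  exact laverage_congr (by filter_upwards [ae_restrict_of_ae h] with y hy using by rw [hy])

theorem fracSharp_coe (f : P → ℝ) (x : P) : fracSharp μ (fun y => (f y : EReal)) x =
    ⨆ (r : ℝ) (_ : 0 < r), (ENNReal.ofReal r)⁻¹ * ⨍⁻ y in Metric.ball x r,
      ENNReal.ofReal |f y - ⨍ z in Metric.ball x r, f z ∂μ| ∂μ := by
  simp only [fracSharp, EReal.abs_coe_sub_coe, EReal.toReal_coe]

theorem laverage_le_of_fracSharp_le {f : P → ℝ} {x : P} {σ r : ℝ}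
    (h : fracSharp μ (fun y => (f y : EReal)) x ≤ ENNReal.ofReal σ) (hr : 0 < r) :
    ⨍⁻ y in Metric.ball x r, ENNReal.ofReal |f y - ⨍ z in Metric.ball x r, f z ∂μ| ∂μ ≤
      ENNReal.ofReal (r * σ) := by
  rw [fracSharp_coe] at h
  have h1 := (le_iSup₂ (f := fun (r : ℝ) (_ : 0 < r) => (ENNReal.ofReal r)⁻¹ *
    ⨍⁻ y in Metric.ball x r, ENNReal.ofReal |f y - ⨍ z in Metric.ball x r, f z ∂μ| ∂μ) r hr).trans h
  rw [ENNReal.ofReal_mul hr.le]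
  rwa [ENNReal.inv_mul_le_iff (by simpa using hr) ENNReal.ofReal_ne_top] at h1

theorem fracSharp_comp_le (hball : ∀ (x : P) (r : ℝ), 0 < r →
      0 < μ (Metric.ball x r) ∧ μ (Metric.ball x r) < ∞) {f : P → ℝ}
    (hf : ∀ x r, IntegrableOn f (Metric.ball x r) μ) {φ : ℝ → ℝ} (hφ : LipschitzWith 1 φ) (x : P) :
    fracSharp μ (fun y => (φ (f y) : EReal)) x ≤ 2 * fracSharp μ (fun y => (f y : EReal)) x := by
  rw [fracSharp_coe (fun y => φ (f y)), fracSharp_coe]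
  refine iSup₂_le fun r hr => ?_
  refine le_trans ?_ (mul_le_mul_right (le_iSup₂ r hr) _)
  rw [mul_left_comm]
  exact mul_le_mul_right (laverage_comp_sub_average_le (hball x r hr).1.ne' (hball x r hr).2.ne
    (hf x r) hφ) _

theorem abs_setAverage_sub_setAverage_le (hball : ∀ (x : P) (r : ℝ), 0 < r →
      0 < μ (Metric.ball x r) ∧ μ (Metric.ball x r) < ∞) {f : P → ℝ}
    (hf : ∀ x r, IntegrableOn f (Metric.ball x r) μ) {x z : P} {r s σ : ℝ} (hr : 0 < r)
    (hs : 0 < s) (hσ : 0 ≤ σ) (hsub : Metric.ball z s ⊆ Metric.ball x r) {D : ℝ≥0}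
    (hD : μ (Metric.ball x r) ≤ D * μ (Metric.ball z s))
    (hx : fracSharp μ (fun y => (f y : EReal)) x ≤ ENNReal.ofReal σ) :
    |(⨍ y in Metric.ball z s, f y ∂μ) - ⨍ y in Metric.ball x r, f y ∂μ| ≤ D * (r * σ) := by
  have h1 := ofReal_abs_setAverage_sub_le (hball z s hs).1.ne' (hball z s hs).2.ne (hf z s)
    (⨍ y in Metric.ball x r, f y ∂μ)
  have h2 := h1.trans (setLAverage_le_mul_of_subset hsub (hball z s hs).1.ne' (hball x r hr).2.ne
    hD _)
  have h3 := h2.trans (mul_le_mul_right (laverage_le_of_fracSharp_le hx hr) _)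
  rw [← ENNReal.ofReal_coe_nnreal, ← ENNReal.ofReal_mul D.coe_nonneg] at h3
  exact (ENNReal.ofReal_le_ofReal_iff (by positivity)).1 h3

theorem integrableOn_ball_of_abs_le
    (hball : ∀ (x : P) (r : ℝ), 0 < r → 0 < μ (Metric.ball x r) ∧ μ (Metric.ball x r) < ∞)
    {f : P → ℝ} (hfm : AEMeasurable f μ) {τ : ℝ} (hτ : ∀ x, |f x| ≤ τ) (x : P) (r : ℝ) :
    IntegrableOn f (Metric.ball x r) μ := by
  rcases lt_or_ge 0 r with hr | hr
  · exact Measure.integrableOn_of_bounded (hball x r hr).2.ne hfm.aestronglyMeasurable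
      (M := τ) (ae_of_all _ hτ)
  · rw [Metric.ball_eq_empty.2 hr]
    exact integrableOn_empty

/-- Points where the averages over shrinking balls converge. -/
def IsBallLebesguePoint (μ : Measure P) (f : P → ℝ) (x : P) : Prop :=
  ∀ r : ℝ, 0 < r → Tendsto (fun i : ℕ => ⨍ y in Metric.ball x (r / 2 ^ i), f y ∂μ) atTop (𝓝 (f x))

theorem IsBallLebesguePoint.abs_sub_le (hball : ∀ (x : P) (r : ℝ), 0 < r →
      0 < μ (Metric.ball x r) ∧ μ (Metric.ball x r) < ∞) {C : ℝ≥0}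
    (hC : ∀ (x : P) (r : ℝ), 0 < r → μ (Metric.ball x (2 * r)) ≤ C * μ (Metric.ball x r))
    {f : P → ℝ} (hf : ∀ x r, IntegrableOn f (Metric.ball x r) μ) {x : P} {r σ : ℝ} (hr : 0 < r)
    (hσ : 0 ≤ σ) (hleb : IsBallLebesguePoint μ f x)
    (hx : fracSharp μ (fun y => (f y : EReal)) x ≤ ENNReal.ofReal σ) :
    |(⨍ y in Metric.ball x r, f y ∂μ) - f x| ≤ 2 * C * r * σ := by
  -- Consecutive averages differ by at most `C * σ * r / 2 ^ i`; the geometric series sums to `2 * C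
  -- * r * σ`.
  have hstep : ∀ i : ℕ, dist (⨍ y in Metric.ball x (r / 2 ^ i), f y ∂μ)
      (⨍ y in Metric.ball x (r / 2 ^ (i + 1)), f y ∂μ) ≤ 2 * C * r * σ / 2 / 2 ^ i := by
    intro i
    have hi : 0 < r / 2 ^ i := by positivity
    have hi' : 0 < r / 2 ^ (i + 1) := by positivity
    have heq : r / 2 ^ i = 2 * (r / 2 ^ (i + 1)) := by rw [pow_succ]; field_simp
    have := abs_setAverage_sub_setAverage_le hball hf hi hi' hσ
      (Metric.ball_subset_ball (x := x) (by linarith)) (D := C) (by rw [heq]; exact hC x _ hi') hx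
    rw [dist_comm, Real.dist_eq]
    refine this.trans_eq ?_
    ring
  have h := dist_le_of_le_geometric_two_of_tendsto₀ hstep (hleb r hr)
  rwa [pow_zero, div_one, Real.dist_eq] at h

/-- Functions are Lipschitz on sublevel sets of their fractional sharp maximal functions. -/
theorem IsBallLebesguePoint.abs_sub_le_mul_dist (hball : ∀ (x : P) (r : ℝ), 0 < r →
      0 < μ (Metric.ball x r) ∧ μ (Metric.ball x r) < ∞) {C : ℝ≥0}
    (hC : ∀ (x : P) (r : ℝ), 0 < r → μ (Metric.ball x (2 * r)) ≤ C * μ (Metric.ball x r))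
    {f : P → ℝ} (hf : ∀ x r, IntegrableOn f (Metric.ball x r) μ) {x y : P} {σ : ℝ}
    (hσ : 0 ≤ σ) (hxy : 0 < dist x y)
    (hlx : IsBallLebesguePoint μ f x) (hly : IsBallLebesguePoint μ f y)
    (hx : fracSharp μ (fun z => (f z : EReal)) x ≤ ENNReal.ofReal σ)
    (hy : fracSharp μ (fun z => (f z : EReal)) y ≤ ENNReal.ofReal σ) :
    |f x - f y| ≤ (6 * C + 2 * C ^ 2) * σ * dist x y := by
  set d := dist x y with hd
  -- The constant splits as `4 * C` from the chain at `x` started at radius `2 * d`, `2 * C` from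
  -- the chain at `y` started at radius `d`, and `2 * C ^ 2` from comparing the two initial balls.
  have h1 := hlx.abs_sub_le hball hC hf (r := 2 * d) (by positivity) hσ hx
  have h2 := hly.abs_sub_le hball hC hf (r := d) hxy hσ hy
  have hsub : Metric.ball y d ⊆ Metric.ball x (2 * d) := Metric.ball_subset_ball' (by
    rw [dist_comm y x, ← hd]; linarith)
  have hD : μ (Metric.ball x (2 * d)) ≤ (C ^ 2 : ℝ≥0) * μ (Metric.ball y d) :=
    calc μ (Metric.ball x (2 * d)) ≤ μ (Metric.ball y (2 * (2 * d))) :=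
          measure_mono (Metric.ball_subset_ball' (by rw [← hd]; linarith))
      _ ≤ C * μ (Metric.ball y (2 * d)) := hC _ _ (by positivity)
      _ ≤ C * (C * μ (Metric.ball y d)) := mul_le_mul_right (hC _ _ hxy) _
      _ = _ := by rw [← mul_assoc, ← ENNReal.coe_mul, sq]
  have h3 := abs_setAverage_sub_setAverage_le hball hf (by positivity) hxy hσ hsub hD hx
  rw [NNReal.coe_pow] at h3
  rw [abs_le] at *
  constructor <;> nlinarith

end FracSharp

/-! ### Separability, measurability and Lebesgue differentiation -/

section DoublingSpace

variable {P : Type*} [MetricSpace P] [MeasurableSpace P] [BorelSpace P] {μ : Measure P}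

/-- Disjoint balls of positive measure form a countable family. The Vitali covering lemma chooses
such balls of radius `ε / 5` whose fivefold enlargements cover the space, so their centres form a
countable `ε`-net. -/
theorem secondCountableTopology_of_measure_ball_pos [SFinite μ]
    (hball : ∀ (x : P) (r : ℝ), 0 < r → 0 < μ (Metric.ball x r)) : SecondCountableTopology P := by
  refine Metric.secondCountable_of_almost_dense_set fun ε hε => ?_
  obtain ⟨s, -, hdisj, hcov⟩ := Vitali.exists_disjoint_subfamily_covering_enlargement_closedBall
    (univ : Set P) id (fun _ => ε / 5) (ε / 5) (fun _ _ => le_rfl) 5 (by norm_num)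
  refine ⟨s, ?_, fun x => ?_⟩
  · have h := Measure.countable_meas_pos_of_disjoint_iUnion (μ := μ)
      (As := fun x : s => Metric.closedBall (x : P) (ε / 5))
      (fun _ => Metric.isClosed_closedBall.measurableSet)
      (fun x y hxy => hdisj x.2 y.2 (fun h => hxy (Subtype.ext h)))
    have huniv : {i : s | 0 < μ (Metric.closedBall (i : P) (ε / 5))} = univ :=
      eq_univ_of_forall fun x => (hball x _ (by positivity)).trans_le
        (measure_mono Metric.ball_subset_closedBall)
    rw [huniv] at h
    exact countable_coe_iff.1 (countable_univ_iff.1 h)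
  · obtain ⟨y, hy, hsub⟩ := hcov x (mem_univ x)
    refine ⟨y, hy, ?_⟩
    have := hsub (Metric.mem_closedBall_self (by positivity))
    rw [Metric.mem_closedBall] at this
    simpa [mul_div_cancel₀] using this

/-- The set of pairs at distance less than `r` is product measurable by second countability, so
sections can be measured and integrated as in Fubini's theorem. -/
theorem measurable_setAverage_ball [SFinite μ] [SecondCountableTopology P] {f : P → ℝ}
    (hf : Measurable f) (r : ℝ) : Measurable fun x => ⨍ z in Metric.ball x r, f z ∂μ := by
  have hS : MeasurableSet {p : P × P | dist p.2 p.1 < r} :=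
    measurableSet_lt (measurable_snd.dist measurable_fst) measurable_const
  simp only [setAverage_eq, smul_eq_mul, measureReal_def]
  refine Measurable.mul ?_ ?_
  · exact (measurable_measure_prodMk_left hS).ennreal_toReal.inv
  · have h := ((hf.comp measurable_snd).indicator hS).stronglyMeasurable.integral_prod_right'
      (ν := μ)
    have heq : (fun x => ∫ z in Metric.ball x r, f z ∂μ) = fun x =>
        ∫ y, {p : P × P | dist p.2 p.1 < r}.indicator (f ∘ Prod.snd) (x, y) ∂μ := by
      funext x
      rw [← integral_indicator Metric.isOpen_ball.measurableSet]
      rfl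
    exact heq ▸ h.measurable

theorem measurable_laverage_ball_sub [SFinite μ] [SecondCountableTopology P] {f : P → ℝ}
    (hf : Measurable f) (r : ℝ) : Measurable fun x => ⨍⁻ y in Metric.ball x r,
      ENNReal.ofReal |f y - ⨍ z in Metric.ball x r, f z ∂μ| ∂μ := by
  have hS : MeasurableSet {p : P × P | dist p.2 p.1 < r} :=
    measurableSet_lt (measurable_snd.dist measurable_fst) measurable_const
  simp only [setLAverage_eq]
  refine Measurable.div ?_ (measurable_measure_prodMk_left hS)
  have hm : Measurable fun p : P × P =>
      ENNReal.ofReal |f p.2 - ⨍ z in Metric.ball p.1 r, f z ∂μ| := by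
    have : Measurable fun p : P × P => ⨍ z in Metric.ball p.1 r, f z ∂μ :=
      (measurable_setAverage_ball (μ := μ) hf r).comp measurable_fst
    exact (((hf.comp measurable_snd).sub this).abs).ennreal_ofReal
  have h := (hm.indicator hS).lintegral_prod_right' (ν := μ)
  have heq : (fun x => ∫⁻ y in Metric.ball x r,
      ENNReal.ofReal |f y - ⨍ z in Metric.ball x r, f z ∂μ| ∂μ) = fun x =>
      ∫⁻ y, {p : P × P | dist p.2 p.1 < r}.indicator
        (fun p => ENNReal.ofReal |f p.2 - ⨍ z in Metric.ball p.1 r, f z ∂μ|) (x, y) ∂μ := by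
    funext x
    rw [← lintegral_indicator Metric.isOpen_ball.measurableSet]
    rfl
  exact heq ▸ h

/-- Let rational radii increase to `r`. The balls exhaust the open ball, their averages converge,
and Fatou's lemma bounds the oscillation at `r` by those at the rational radii. The supremum thus
becomes countable, which gives measurability of the maximal function. -/
theorem mean_oscillation_le_iSup
    (hball : ∀ (x : P) (r : ℝ), 0 < r → 0 < μ (Metric.ball x r) ∧ μ (Metric.ball x r) < ∞)
    {f : P → ℝ} (hfm : Measurable f)
    (hf : ∀ x r, IntegrableOn f (Metric.ball x r) μ) (x : P) {r : ℝ} (hr : 0 < r) :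
    (ENNReal.ofReal r)⁻¹ * ⨍⁻ y in Metric.ball x r,
      ENNReal.ofReal |f y - ⨍ z in Metric.ball x r, f z ∂μ| ∂μ ≤
    ⨆ (q : ℚ) (_ : 0 < q), (ENNReal.ofReal q)⁻¹ * ⨍⁻ y in Metric.ball x q,
      ENNReal.ofReal |f y - ⨍ z in Metric.ball x q, f z ∂μ| ∂μ := by
  set S := ⨆ (q : ℚ) (_ : 0 < q), (ENNReal.ofReal q)⁻¹ * ⨍⁻ y in Metric.ball x q,
      ENNReal.ofReal |f y - ⨍ z in Metric.ball x q, f z ∂μ| ∂μ with hS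
  obtain ⟨q, hq_mono, hmem, hlim⟩ :=
    Rat.denseRange_cast.exists_seq_strictMono_tendsto_of_lt Rat.cast_mono hr
  let t : ℕ → ℝ := fun n => q n
  change Tendsto t atTop (𝓝 r) at hlim
  have hmono : Monotone t := fun a b hab => Rat.cast_mono (hq_mono.monotone hab)
  set m := ⨍ z in Metric.ball x r, f z ∂μ
  let M : ℕ → ℝ := fun n => ⨍ z in Metric.ball x (t n), f z ∂μ
  have hB : ∀ s, MeasurableSet (Metric.ball x s) := fun s => Metric.isOpen_ball.measurableSet
  have hmonoB : Monotone fun n => Metric.ball x (t n) :=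
    fun a b hab => Metric.ball_subset_ball (hmono hab)
  have hU : ⋃ n, Metric.ball x (t n) = Metric.ball x r := by
    refine Subset.antisymm (iUnion_subset fun n => Metric.ball_subset_ball (hmem n).2.le) ?_
    intro y hy
    obtain ⟨n, hn⟩ := (hlim.eventually (lt_mem_nhds (Metric.mem_ball.1 hy))).exists
    exact mem_iUnion.2 ⟨n, hn⟩
  have hM : Tendsto M atTop (𝓝 m) := by
    simp only [M, m, setAverage_eq, smul_eq_mul, measureReal_def]
    refine Tendsto.mul (Tendsto.inv₀ ?_ ?_) ?_
    · refine (ENNReal.tendsto_toReal (hball x r hr).2.ne).comp ?_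
      rw [← hU]
      exact tendsto_measure_iUnion_atTop hmonoB
    · exact (ENNReal.toReal_pos (hball x r hr).1.ne' (hball x r hr).2.ne).ne'
    · rw [← hU]
      exact tendsto_setIntegral_of_monotone (fun n => hB _) hmonoB (by rw [hU]; exact hf x r)
  -- The normalization belongs to the larger radius `r`, so it is at most the one at the radius `q
  -- n`.
  have hterm : ∀ n, (ENNReal.ofReal r)⁻¹ * (μ (Metric.ball x r))⁻¹ *
      ∫⁻ y, (Metric.ball x (t n)).indicator (fun y => ENNReal.ofReal |f y - M n|) y ∂μ ≤ S := by
    intro n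
    have hq0 : 0 < q n := Rat.cast_pos.1 (hmem n).1
    refine le_trans ?_ (le_iSup₂ (f := fun (q : ℚ) (_ : 0 < q) => (ENNReal.ofReal q)⁻¹ *
      ⨍⁻ y in Metric.ball x q, ENNReal.ofReal |f y - ⨍ z in Metric.ball x q, f z ∂μ| ∂μ) (q n) hq0)
    rw [lintegral_indicator (hB _), setLAverage_eq, div_eq_mul_inv, mul_assoc,
      mul_comm (∫⁻ _ in Metric.ball x (q n), _ ∂_)]
    have hle := (hmem n).2.le
    change t n ≤ r at hle
    refine mul_le_mul' (ENNReal.inv_le_inv.2 (ENNReal.ofReal_le_ofReal hle))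
      (mul_le_mul' (ENNReal.inv_le_inv.2 (measure_mono (Metric.ball_subset_ball hle))) le_rfl)
  have hfatou : ∫⁻ y, (Metric.ball x r).indicator (fun y => ENNReal.ofReal |f y - m|) y ∂μ ≤
      liminf (fun n => ∫⁻ y, (Metric.ball x (t n)).indicator
        (fun y => ENNReal.ofReal |f y - M n|) y ∂μ) atTop := by
    refine le_trans (lintegral_mono fun y => ?_) (lintegral_liminf_le fun n => ?_)
    · by_cases hy : y ∈ Metric.ball x r
      · rw [indicator_of_mem hy]
        refine le_of_eq (Tendsto.liminf_eq ?_).symm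
        have h1 : Tendsto (fun n => ENNReal.ofReal |f y - M n|) atTop
            (𝓝 (ENNReal.ofReal |f y - m|)) :=
          (ENNReal.continuous_ofReal.tendsto _).comp ((tendsto_const_nhds.sub hM).abs)
        refine h1.congr' ?_
        filter_upwards [hlim.eventually (lt_mem_nhds (Metric.mem_ball.1 hy))] with n hn
        rw [indicator_of_mem (Metric.mem_ball.2 hn)]
      · rw [indicator_of_notMem hy]
        exact zero_le
    · exact ((hfm.sub_const _).abs.ennreal_ofReal).indicator (hB _)
  have hc0 : (ENNReal.ofReal r)⁻¹ * (μ (Metric.ball x r))⁻¹ ≠ ∞ :=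
    ENNReal.mul_ne_top (ENNReal.inv_ne_top.2 (by simpa using hr))
      (ENNReal.inv_ne_top.2 (hball x r hr).1.ne')
  rw [setLAverage_eq, div_eq_mul_inv, mul_comm (∫⁻ _ in _, _ ∂_), ← mul_assoc,
    ← lintegral_indicator (hB _)]
  refine (mul_le_mul_right hfatou _).trans ?_
  rw [← ENNReal.liminf_const_mul_of_ne_top hc0]
  exact (liminf_le_liminf (Eventually.of_forall hterm)).trans_eq (liminf_const _)

theorem measurable_fracSharp_coe [SFinite μ] [SecondCountableTopology P]
    (hball : ∀ (x : P) (r : ℝ), 0 < r → 0 < μ (Metric.ball x r) ∧ μ (Metric.ball x r) < ∞)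
    {f : P → ℝ}
    (hfm : Measurable f) (hf : ∀ x r, IntegrableOn f (Metric.ball x r) μ) :
    Measurable (fracSharp μ fun x => (f x : EReal)) := by
  have heq : (fracSharp μ fun x => (f x : EReal)) = fun x =>
      ⨆ (q : ℚ) (_ : 0 < q), (ENNReal.ofReal q)⁻¹ * ⨍⁻ y in Metric.ball x q,
        ENNReal.ofReal |f y - ⨍ z in Metric.ball x q, f z ∂μ| ∂μ := by
    funext x
    rw [fracSharp_coe]
    refine le_antisymm (iSup₂_le fun r hr => mean_oscillation_le_iSup hball hfm hf x hr) ?_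
    exact iSup₂_le fun q hq => le_iSup₂ (f := fun (r : ℝ) (_ : 0 < r) => (ENNReal.ofReal r)⁻¹ *
      ⨍⁻ y in Metric.ball x r, ENNReal.ofReal |f y - ⨍ z in Metric.ball x r, f z ∂μ| ∂μ)
      (q : ℝ) (by exact_mod_cast hq)
  rw [heq]
  exact Measurable.iSup fun q => Measurable.iSup fun _ =>
    (measurable_laverage_ball_sub hfm _).const_mul _

/-- Lebesgue differentiation is applied to closed balls. By doubling, the mean of `|f - f x|` over
an open ball is at most `C` times that over the closed ball of the same radius. -/
theorem ae_isBallLebesguePoint [SecondCountableTopology P]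
    (hball : ∀ (x : P) (r : ℝ), 0 < r → 0 < μ (Metric.ball x r) ∧ μ (Metric.ball x r) < ∞)
    {C : ℝ≥0}
    (hC : ∀ (x : P) (r : ℝ), 0 < r → μ (Metric.ball x (2 * r)) ≤ C * μ (Metric.ball x r))
    {f : P → ℝ} (hf : ∀ x r, IntegrableOn f (Metric.ball x r) μ) :
    ∀ᵐ x ∂μ, IsBallLebesguePoint μ f x := by
  have : IsLocallyFiniteMeasure μ := ⟨fun x => ⟨Metric.ball x 1, Metric.ball_mem_nhds x one_pos,
    (hball x 1 one_pos).2⟩⟩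
  have hcb : ∀ (x : P) (r : ℝ), 0 < r →
      μ (Metric.closedBall x r) ≤ C * μ (Metric.ball x r) := fun x r hr =>
    (measure_mono (Metric.closedBall_subset_ball (by linarith))).trans (hC x r hr)
  have : IsUnifLocDoublingMeasure μ := by
    -- One factor `C` passes from the closed to the open ball, the other halves the radius.
    refine ⟨⟨C * C, ?_⟩⟩
    filter_upwards [self_mem_nhdsWithin] with r hr x
    have hr : 0 < r := hr
    calc μ (Metric.closedBall x (2 * r)) ≤ C * μ (Metric.ball x (2 * r)) := hcb _ _ (by positivity)
      _ ≤ C * (C * μ (Metric.ball x r)) := mul_le_mul_right (hC x r hr) _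
      _ ≤ C * (C * μ (Metric.closedBall x r)) := by
          gcongr; exact Metric.ball_subset_closedBall
      _ = _ := by rw [← mul_assoc, ENNReal.coe_mul]
  have hloc : LocallyIntegrable f μ := fun x =>
    ⟨Metric.ball x 1, Metric.ball_mem_nhds x one_pos, hf x 1⟩
  filter_upwards [IsUnifLocDoublingMeasure.ae_tendsto_average_norm_sub μ hloc 1] with x hx r hr
  have hpos : ∀ i : ℕ, 0 < r / 2 ^ i := fun i => by positivity
  have hδ : Tendsto (fun i : ℕ => r / 2 ^ i) atTop (𝓝[>] 0) := by
    refine tendsto_nhdsWithin_iff.2 ⟨?_, Eventually.of_forall hpos⟩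
    exact tendsto_const_nhds.div_atTop (tendsto_pow_atTop_atTop_of_one_lt one_lt_two)
  have h := hx (fun _ => x) (fun i : ℕ => r / 2 ^ i) hδ
    (Eventually.of_forall fun i => Metric.mem_closedBall_self (by have := hpos i; positivity))
  rw [tendsto_iff_dist_tendsto_zero]
  refine squeeze_zero (fun _ => dist_nonneg) (fun i => ?_)
    (by simpa using h.const_mul (C : ℝ))
  have hfin : μ (Metric.closedBall x (r / 2 ^ i)) ≠ ∞ :=
    ((hcb x _ (hpos i)).trans_lt (ENNReal.mul_lt_top ENNReal.coe_lt_top (hball x _ (hpos i)).2)).ne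
  have h1 := ofReal_abs_setAverage_sub_le (hball x _ (hpos i)).1.ne' (hball x _ (hpos i)).2.ne
    (hf x (r / 2 ^ i)) (f x)
  have h2 := h1.trans (setLAverage_le_mul_of_subset (Metric.ball_subset_closedBall (x := x))
    (hball x _ (hpos i)).1.ne' hfin (hcb x _ (hpos i)) _)
  have hint : IntegrableOn (fun y => |f y - f x|) (Metric.closedBall x (r / 2 ^ i)) μ := by
    refine Integrable.abs (Integrable.sub ?_ (integrableOn_const hfin))
    exact (hf x (2 * (r / 2 ^ i))).mono_set
      (Metric.closedBall_subset_ball (by linarith [hpos i]))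
  have h3 : ⨍⁻ y in Metric.closedBall x (r / 2 ^ i), ENNReal.ofReal |f y - f x| ∂μ =
      ENNReal.ofReal (⨍ y in Metric.closedBall x (r / 2 ^ i), ‖f y - f x‖ ∂μ) := by
    rw [setLAverage_eq]
    exact (ofReal_setAverage hint (ae_of_all _ fun y => abs_nonneg _)).symm
  rw [h3, ← ENNReal.ofReal_coe_nnreal, ← ENNReal.ofReal_mul C.coe_nonneg] at h2
  rw [Real.dist_eq]
  refine (ENNReal.ofReal_le_ofReal_iff (mul_nonneg C.coe_nonneg ?_)).1 h2
  rw [setAverage_eq]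
  exact smul_nonneg (by positivity) (integral_nonneg fun y => abs_nonneg (f y - f x))

end DoublingSpace

/-! ### Truncations -/

/-- Truncation of real numbers at the levels `±τ`. -/
noncomputable def clamp (τ t : ℝ) : ℝ := max (min t τ) (-τ)

theorem lipschitzWith_clamp (τ : ℝ) : LipschitzWith 1 (clamp τ) :=
  (LipschitzWith.id.min_const τ).max_const (-τ)

theorem abs_clamp_le {τ : ℝ} (hτ : 0 ≤ τ) (t : ℝ) : |clamp τ t| ≤ τ :=
  abs_le.2 ⟨le_max_right _ _, max_le (min_le_right _ _) (by linarith)⟩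

theorem clamp_eq_self {τ t : ℝ} (ht : |t| ≤ τ) : clamp τ t = t := by
  rw [abs_le] at ht
  rw [clamp, min_eq_left ht.2, max_eq_left ht.1]

theorem abs_sub_clamp_sub_le {τ : ℝ} (hτ : 0 ≤ τ) (s t : ℝ) :
    |(s - clamp τ s) - (t - clamp τ t)| ≤ |s - t| := by
  simp only [clamp]
  grind

theorem abs_sub_clamp_le {τ : ℝ} (hτ : 0 ≤ τ) (t : ℝ) : |t - clamp τ t| ≤ |t| := by
  simp only [clamp]
  grind

section Truncation

variable {P : Type*} {u : P → EReal}

theorem truncation_of_eq_coe {τ t : ℝ} {x : P} (h : u x = t) :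
    truncation u τ x = (clamp τ t : ℝ) := by
  rw [truncation, h, clamp, EReal.coe_strictMono.monotone.map_max,
    EReal.coe_strictMono.monotone.map_min, EReal.coe_neg]

theorem exists_truncation_eq_coe {τ : ℝ} (hτ : 0 ≤ τ) (x : P) :
    ∃ a : ℝ, |a| ≤ τ ∧ truncation u τ x = a := by
  have hle : (-(τ : EReal)) ≤ τ := by
    rw [← EReal.coe_neg, EReal.coe_le_coe_iff]
    linarith
  induction h : u x with
  | coe t => exact ⟨clamp τ t, abs_clamp_le hτ t, truncation_of_eq_coe h⟩
  | top =>
    refine ⟨τ, by rw [abs_of_nonneg hτ], ?_⟩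
    rw [truncation, h, min_eq_right le_top, max_eq_left hle]
  | bot =>
    refine ⟨-τ, by rw [abs_neg, abs_of_nonneg hτ], ?_⟩
    rw [truncation, h, min_eq_left bot_le, max_eq_right bot_le, EReal.coe_neg]

theorem abs_truncation_le {τ : ℝ} (hτ : 0 ≤ τ) (x : P) : (truncation u τ x).abs ≤ (u x).abs := by
  by_cases h : (u x).abs < ∞
  · obtain ⟨t, ht⟩ := EReal.exists_coe_eq_of_abs_lt_top h
    rw [truncation_of_eq_coe ht, ht, EReal.abs_def, EReal.abs_def]
    refine ENNReal.ofReal_le_ofReal ?_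
    simp only [clamp]
    grind
  · rw [not_lt_top_iff.1 h]
    exact le_top

theorem abs_truncation_sub_le (τ : ℝ) (x y : P) :
    (truncation u τ x - truncation u τ y).abs ≤ (u x - u y).abs := by
  by_cases h : (u x - u y).abs < ∞
  · obtain ⟨a, b, ha, hb⟩ := EReal.exists_coe_of_abs_sub_lt_top h
    rw [truncation_of_eq_coe ha, truncation_of_eq_coe hb, ha, hb, EReal.abs_coe_sub_coe,
      EReal.abs_coe_sub_coe]
    refine ENNReal.ofReal_le_ofReal ?_
    simpa [Real.dist_eq] using (lipschitzWith_clamp τ).dist_le_mul a b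
  · rw [not_lt_top_iff.1 h]
    exact le_top

theorem abs_sub_truncation_le {τ : ℝ} (hτ : 0 ≤ τ) (x : P) :
    (u x - truncation u τ x).abs ≤ (u x).abs := by
  by_cases h : (u x).abs < ∞
  · obtain ⟨t, ht⟩ := EReal.exists_coe_eq_of_abs_lt_top h
    rw [truncation_of_eq_coe ht, ht, EReal.abs_coe_sub_coe, EReal.abs_def]
    exact ENNReal.ofReal_le_ofReal (abs_sub_clamp_le hτ t)
  · rw [not_lt_top_iff.1 h]
    exact le_top

theorem sub_truncation_eq_zero {τ : ℝ} (x : P) (h : (u x).abs ≤ ENNReal.ofReal τ) (hτ : 0 ≤ τ) :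
    u x - truncation u τ x = 0 := by
  obtain ⟨t, ht⟩ := EReal.exists_coe_eq_of_abs_lt_top (h.trans_lt ENNReal.ofReal_lt_top)
  rw [ht, EReal.abs_def, ENNReal.ofReal_le_ofReal_iff hτ] at h
  rw [truncation_of_eq_coe ht, ht, clamp_eq_self h, ← EReal.coe_sub, sub_self, EReal.coe_zero]

/-- The map `t ↦ t - clamp τ t` is 1-Lipschitz, so every upper gradient of `u` is one of the tail `u
- truncation u τ`. -/
theorem abs_sub_truncation_sub_le {τ : ℝ} (hτ : 0 ≤ τ) (x y : P) :
    ((u x - truncation u τ x) - (u y - truncation u τ y)).abs ≤ (u x - u y).abs := by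
  by_cases h : (u x - u y).abs < ∞
  · obtain ⟨a, b, ha, hb⟩ := EReal.exists_coe_of_abs_sub_lt_top h
    rw [truncation_of_eq_coe ha, truncation_of_eq_coe hb, ha, hb, ← EReal.coe_sub,
      ← EReal.coe_sub, EReal.abs_coe_sub_coe, EReal.abs_coe_sub_coe]
    exact ENNReal.ofReal_le_ofReal (abs_sub_clamp_sub_le hτ a b)
  · rw [not_lt_top_iff.1 h]
    exact le_top

theorem AEMeasurable.truncation [MeasurableSpace P] {μ : Measure P} (hu : AEMeasurable u μ)
    (τ : ℝ) : AEMeasurable (truncation u τ) μ :=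
  (hu.min aemeasurable_const).max aemeasurable_const

end Truncation

theorem AEMeasurable.ereal_sub {P : Type*} [MeasurableSpace P] {μ : Measure P} {u v : P → EReal}
    (hu : AEMeasurable u μ) (hv : AEMeasurable v μ) : AEMeasurable (fun x => u x - v x) μ := by
  simp only [sub_eq_add_neg]
  exact hu.add hv.neg

/-! ### The Newtonian norm and level sets -/

namespace QuasiBanachFunctionLattice

section Newton

variable {P : Type*} [PseudoEMetricSpace P] [MeasurableSpace P] {μ : Measure P}
  (X : QuasiBanachFunctionLattice μ)

theorem newtonNorm_le {u : P → EReal} {g : P → ℝ≥0∞} (hg : IsUpperGradient u g) :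
    X.newtonNorm u ≤ X.nrm u + X.enrm g :=
  add_le_add le_rfl (iInf₂_le g hg)

theorem exists_isUpperGradient_of_memNewton {X : QuasiBanachFunctionLattice μ} {u : P → EReal}
    (hu : X.MemNewton u) : ∃ g, IsUpperGradient u g ∧ X.enrm g < ∞ := by
  have h := (ENNReal.add_lt_top.1 hu.2).2
  obtain ⟨g, hg⟩ := iInf_lt_iff.1 h
  obtain ⟨hg, hlt⟩ := iInf_lt_iff.1 hg
  exact ⟨g, hg, hlt⟩

/-- Pointwise bounds replace an identity `w = u + v`: they cover differences as well as sums and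
remain meaningful at infinite values. -/
theorem newtonNorm_le_of_abs_le {u v w : P → EReal} {g h : P → ℝ≥0∞} (hu : AEMeasurable u μ)
    (hv : AEMeasurable v μ) (hw : AEMeasurable w μ) (hg : IsUpperGradient u g)
    (hh : IsUpperGradient v h) (habs : ∀ x, (w x).abs ≤ (u x).abs + (v x).abs)
    (hsub : ∀ x y, (w x - w y).abs ≤ (u x - u y).abs + (v x - v y).abs) :
    X.newtonNorm w ≤ X.c * ((X.nrm u + X.enrm g) + (X.nrm v + X.enrm h)) := by
  refine (X.newtonNorm_le (hg.add hh hsub)).trans ?_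
  refine (add_le_add (X.nrm_add_le_of_abs_le hu hv hw (ae_of_all _ habs))
    (X.enrm_add_le hg.1.aemeasurable hh.1.aemeasurable)).trans_eq ?_
  ring

end Newton

end QuasiBanachFunctionLattice

theorem tendsto_inv_nat_add_one_mul {a : ℝ≥0∞} (ha : a ≠ ∞) :
    Tendsto (fun n : ℕ => (((n : ℝ≥0) + 1)⁻¹ : ℝ≥0) * a) atTop (𝓝 0) := by
  have h : Tendsto (fun n : ℕ => ((((n : ℝ≥0) + 1)⁻¹ : ℝ≥0) : ℝ≥0∞)) atTop (𝓝 0) := by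
    rw [← ENNReal.coe_zero, ENNReal.tendsto_coe]
    simpa [one_div] using tendsto_one_div_add_atTop_nhds_zero_nat (𝕜 := ℝ≥0)
  simpa using ENNReal.Tendsto.mul_const h (Or.inr ha)

namespace QuasiBanachFunctionLattice

variable {P : Type*} [MeasurableSpace P] {μ : Measure P} {X : QuasiBanachFunctionLattice μ}

/-- Chebyshev's inequality in the lattice: `n χ_{|u| > n} ≤ |u|`. -/
theorem tendsto_enrm_indicator_abs_gt {u : P → EReal} (hu : X.Mem u) :
    Tendsto (fun n : ℕ => X.enrm ({x | ENNReal.ofReal n < (u x).abs}.indicator 1)) atTop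
      (𝓝 0) := by
  have hE : ∀ n : ℕ, NullMeasurableSet {x | ENNReal.ofReal n < (u x).abs} μ := fun n =>
    nullMeasurableSet_lt aemeasurable_const hu.1.ereal_abs
  have hfin : X.enrm (fun x => (u x).abs) ≠ ∞ := by
    rw [← X.nrm_eq_enrm_abs hu.1]
    exact hu.2.ne
  have hlim : Tendsto (fun n : ℕ => (n : ℝ≥0∞)⁻¹ * X.enrm (fun x => (u x).abs)) atTop (𝓝 0) := by
    simpa using ENNReal.Tendsto.mul_const ENNReal.tendsto_inv_nat_nhds_zero (Or.inr hfin)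
  refine tendsto_of_tendsto_of_tendsto_of_le_of_le' tendsto_const_nhds hlim
    (Eventually.of_forall fun _ => zero_le) ?_
  filter_upwards [eventually_ge_atTop 1] with n hn
  have hm := aemeasurable_one.indicator₀ (f := (1 : P → ℝ≥0∞)) (hE n)
  have h := X.enrm_mono (hm.const_mul (n : ℝ≥0)) hu.1.ereal_abs (ae_of_all _ fun x => by
    by_cases hx : ENNReal.ofReal n < (u x).abs
    · rw [indicator_of_mem (by exact hx)]
      simpa using hx.le
    · rw [indicator_of_notMem (by exact hx), mul_zero]
      exact zero_le)
  rw [X.enrm_const_mul _ hm] at h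
  rw [mul_comm, ← div_eq_mul_inv, ENNReal.le_div_iff_mul_le (Or.inl (by simpa using by omega))
    (Or.inl (ENNReal.natCast_ne_top n)), mul_comm]
  simpa using h

end QuasiBanachFunctionLattice

open QuasiBanachFunctionLattice

/-! ### The two approximations -/

/-- Truncations are dense in the Newtonian space. -/
theorem exists_truncation_approx {P : Type*} [PseudoEMetricSpace P] [MeasurableSpace P]
    {μ : Measure P} {X : QuasiBanachFunctionLattice μ} (hX : X.AbsolutelyContinuousNorm)
    {u : P → EReal} (hu : X.Mem u) {g : P → ℝ≥0∞} (hg : IsUpperGradient u g)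
    (hgfin : X.enrm g < ∞) {η : ℝ≥0∞} (hη : 0 < η) :
    ∃ τ : ℝ, 0 < τ ∧ ∃ h, IsUpperGradient (fun x => u x - truncation u τ x) h ∧
      X.nrm (fun x => u x - truncation u τ x) + X.enrm h ≤ η := by
  let E : ℕ → Set P := fun n => {x | ENNReal.ofReal n < (u x).abs}
  have hE : ∀ n, NullMeasurableSet (E n) μ := fun n =>
    nullMeasurableSet_lt aemeasurable_const hu.1.ereal_abs
  have hanti : Antitone E := fun a b hab x hx =>
    lt_of_le_of_lt (ENNReal.ofReal_le_ofReal (Nat.cast_le.2 hab)) hx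
  have hnull := X.measure_iInter_eq_zero_of_tendsto hE (tendsto_enrm_indicator_abs_gt hu)
  have hufin : X.enrm (fun x => (u x).abs) < ∞ := by
    rw [← X.nrm_eq_enrm_abs hu.1]
    exact hu.2
  have h1 := hX.tendsto_enrm_indicator hu.1.ereal_abs hufin hE hanti hnull
  have h2 := hX.tendsto_enrm_indicator hg.1.aemeasurable hgfin hE hanti hnull
  have h3 := tendsto_inv_nat_add_one_mul hgfin.ne
  have hlim : Tendsto (fun n : ℕ => X.enrm ((E n).indicator fun x => (u x).abs) +
      X.c * (X.c * X.enrm ((E n).indicator g) + (((n : ℝ≥0) + 1)⁻¹ : ℝ≥0) * X.enrm g))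
      atTop (𝓝 0) := by
    simpa using h1.add (ENNReal.Tendsto.const_mul ((ENNReal.Tendsto.const_mul h2
      (Or.inr ENNReal.coe_ne_top)).add h3) (Or.inr ENNReal.coe_ne_top))
  obtain ⟨n, hn, hn1⟩ := ((ENNReal.tendsto_nhds_zero.1 hlim η hη).and
    (eventually_ge_atTop 1)).exists
  have hn0 : (0 : ℝ) < n := by exact_mod_cast hn1
  have hv : ∀ x ∉ E n, u x - truncation u n x = 0 := fun x hx =>
    sub_truncation_eq_zero x (not_lt.1 hx) hn0.le
  have hum := hu.1.ereal_sub (hu.1.truncation n)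
  have hug : IsUpperGradient (fun x => u x - truncation u n x)
      (fun x => g x + ((0 : ℝ≥0) : ℝ≥0∞)) := by
    simpa using hg.mono_abs_sub (abs_sub_truncation_sub_le hn0.le)
  -- `E n` is only null measurable while upper gradients must be Borel, so `E n` is replaced by a
  -- measurable hull differing from it by a null set. The factor `δ` tends to zero with `n`.
  refine ⟨n, hn0, _, hug.indicator_add (δ := ((n : ℝ≥0) + 1)⁻¹) (by positivity) hg.1
    (measurableSet_toMeasurable μ (E n)) (fun x hx => hv x fun h => hx (subset_toMeasurable _ _ h)),
    le_trans (add_le_add ?_ ?_) hn⟩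
  · rw [X.nrm_eq_enrm_abs hum]
    refine X.enrm_mono hum.ereal_abs (hu.1.ereal_abs.indicator₀ (hE n)) (ae_of_all _ fun x => ?_)
    by_cases hx : x ∈ E n
    · rw [indicator_of_mem hx]
      exact abs_sub_truncation_le hn0.le x
    · rw [hv x hx, EReal.abs_zero]
      exact zero_le
  · simpa using X.enrm_indicator_add_le (K := 0) (δ := ((n : ℝ≥0) + 1)⁻¹) hg.1
      (measurableSet_toMeasurable μ (E n)) (hE n).toMeasurable_ae_eq

/-- The extension of a bounded function from the good part of a sublevel set of its fractional
sharp maximal function. -/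
theorem exists_lipschitzWith_eqOn_fracSharp_le {P : Type*} [MetricSpace P] [MeasurableSpace P]
    {μ : Measure P}
    (hball : ∀ (x : P) (r : ℝ), 0 < r → 0 < μ (Metric.ball x r) ∧ μ (Metric.ball x r) < ∞)
    {C : ℝ≥0}
    (hC : ∀ (x : P) (r : ℝ), 0 < r → μ (Metric.ball x (2 * r)) ≤ C * μ (Metric.ball x r))
    {f : P → ℝ} (hfm : AEMeasurable f μ) {τ : ℝ} (hτ0 : 0 ≤ τ) (hτ : ∀ x, |f x| ≤ τ) (σ : ℝ≥0) :
    ∃ w : P → ℝ, LipschitzWith ((6 * C + 2 * C ^ 2) * σ) w ∧ (∀ x, |w x| ≤ τ) ∧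
      ∀ x, IsBallLebesguePoint μ f x →
        fracSharp μ (fun y => (f y : EReal)) x ≤ ENNReal.ofReal σ → f x = w x := by
  have hlip : LipschitzOnWith ((6 * C + 2 * C ^ 2) * σ) f {x | IsBallLebesguePoint μ f x ∧
      fracSharp μ (fun y => (f y : EReal)) x ≤ ENNReal.ofReal σ} := by
    refine LipschitzOnWith.of_dist_le_mul fun x hx y hy => ?_
    rcases eq_or_ne x y with rfl | hne
    · simp
    rw [Real.dist_eq]
    simpa using IsBallLebesguePoint.abs_sub_le_mul_dist hball hC
      (integrableOn_ball_of_abs_le hball hfm hτ) σ.coe_nonneg (dist_pos.2 hne) hx.1 hy.1 hx.2 hy.2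
  obtain ⟨w, hw, hwf⟩ := hlip.extend_real
  -- Clamping the McShane extension keeps it bounded by `τ` and changes nothing where it equals `f`.
  refine ⟨fun x => clamp τ (w x), ?_, fun x => abs_clamp_le hτ0 _, fun x hx hx' => ?_⟩
  · have h := (lipschitzWith_clamp τ).comp hw
    rw [one_mul] at h
    exact h
  · change f x = clamp τ (w x)
    rw [← hwf ⟨hx, hx'⟩, clamp_eq_self (hτ x)]

section SharpApproximation

variable {P : Type*} [MetricSpace P] [MeasurableSpace P] [BorelSpace P] {μ : Measure P}

/-- The maximal function depends only on the a.e. class of `f`, so a Borel representative may be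
used, and the result is measurable without passing to the completion. -/
theorem measurable_fracSharp_of_aemeasurable [SFinite μ] [SecondCountableTopology P]
    (hball : ∀ (x : P) (r : ℝ), 0 < r → 0 < μ (Metric.ball x r) ∧ μ (Metric.ball x r) < ∞)
    {f : P → ℝ} (hfm : AEMeasurable f μ) (hf : ∀ x r, IntegrableOn f (Metric.ball x r) μ) :
    Measurable (fracSharp μ fun x => (f x : EReal)) := by
  have hcongr : (fun x => (f x : EReal)) =ᵐ[μ] fun x => ((hfm.mk f x : ℝ) : EReal) := by
    filter_upwards [hfm.ae_eq_mk] with x hx using by rw [hx]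
  rw [fracSharp_congr hcongr]
  exact measurable_fracSharp_coe hball hfm.measurable_mk fun x r =>
    (hf x r).congr (ae_restrict_of_ae hfm.ae_eq_mk)

/-- Bounded functions satisfying the weak estimate are approximated by Lipschitz functions. -/
theorem exists_lipschitz_approx [SFinite μ]
    (hball : ∀ (x : P) (r : ℝ), 0 < r → 0 < μ (Metric.ball x r) ∧ μ (Metric.ball x r) < ∞)
    {C : ℝ≥0}
    (hC : ∀ (x : P) (r : ℝ), 0 < r → μ (Metric.ball x (2 * r)) ≤ C * μ (Metric.ball x r))
    {X : QuasiBanachFunctionLattice μ} (hX : X.AbsolutelyContinuousNorm)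
    {f : P → ℝ} (hfm : AEMeasurable f μ) {τ : ℝ} (hτ0 : 0 ≤ τ) (hτ : ∀ x, |f x| ≤ τ)
    {g : P → ℝ≥0∞} (hg : IsUpperGradient (fun x => (f x : EReal)) g) (hgfin : X.enrm g < ∞)
    (hsharp : SharpWeakEstimate X (fun x => (f x : EReal))) {η : ℝ≥0∞} (hη : 0 < η) :
    ∃ w : P → ℝ, (∃ K, LipschitzWith K w) ∧
      ∃ h, IsUpperGradient (fun x => (f x : EReal) - (w x : EReal)) h ∧
      X.nrm (fun x => (f x : EReal) - (w x : EReal)) + X.enrm h ≤ η := by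
  have := secondCountableTopology_of_measure_ball_pos fun x r hr => (hball x r hr).1
  have hint := integrableOn_ball_of_abs_le hball hfm hτ
  let E : ℕ → Set P := fun n =>
    {x | ENNReal.ofReal n < fracSharp μ (fun y => (f y : EReal)) x}
  have hEm : ∀ n, MeasurableSet (E n) := fun n =>
    measurableSet_lt measurable_const (measurable_fracSharp_of_aemeasurable hball hfm hint)
  have hE : ∀ n, NullMeasurableSet (E n) μ := fun n => (hEm n).nullMeasurableSet
  have hanti : Antitone E := fun a b hab x hx =>
    lt_of_le_of_lt (ENNReal.ofReal_le_ofReal (Nat.cast_le.2 hab)) hx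
  have hone : ∀ n, AEMeasurable ((E n).indicator (1 : P → ℝ≥0∞)) μ := fun n =>
    aemeasurable_one.indicator₀ (hE n)
  have hA : Tendsto (fun n : ℕ => (n : ℝ≥0∞) * X.enrm ((E n).indicator 1)) atTop (𝓝 0) := by
    refine (hsharp.comp tendsto_natCast_atTop_atTop).congr fun n => ?_
    have hm : AEMeasurable ((E n).indicator fun _ => ((n : ℝ) : EReal)) μ :=
      aemeasurable_const.indicator₀ (hE n)
    have h := X.enrm_const_mul (n : ℝ≥0) (hone n)
    rw [ENNReal.coe_natCast] at h
    rw [← h]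
    refine (X.nrm_eq_enrm_abs hm).trans ?_
    congr 1
    funext x
    by_cases hx : x ∈ E n
    · simp only [indicator_of_mem hx, EReal.abs_def, Nat.abs_cast, ENNReal.ofReal_natCast,
        Pi.one_apply, mul_one]
    · simp [hx]
  have he : Tendsto (fun n : ℕ => X.enrm ((E n).indicator 1)) atTop (𝓝 0) := by
    refine tendsto_of_tendsto_of_tendsto_of_le_of_le' tendsto_const_nhds hA
      (Eventually.of_forall fun _ => zero_le) ?_
    filter_upwards [eventually_ge_atTop 1] with n hn
    exact le_mul_of_one_le_left zero_le (by exact_mod_cast hn)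
  have hnull := X.measure_iInter_eq_zero_of_tendsto hE he
  have h2 := hX.tendsto_enrm_indicator hg.1.aemeasurable hgfin hE hanti hnull
  have h3 := tendsto_inv_nat_add_one_mul hgfin.ne
  -- The limit below collects the whole error bound: `2 * τ` bounds `|f - w|`, and `D * n` is the
  -- Lipschitz constant of `w`, paid only on `E n`.
  let D : ℝ≥0 := 6 * C + 2 * C ^ 2
  have hlim : Tendsto (fun n : ℕ => ((2 * τ).toNNReal : ℝ≥0∞) * X.enrm ((E n).indicator 1) +
      X.c * (X.c * (X.enrm ((E n).indicator g) + D * (n * X.enrm ((E n).indicator 1))) +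
        (((n : ℝ≥0) + 1)⁻¹ : ℝ≥0) * X.enrm g)) atTop (𝓝 0) := by
    have hD := ENNReal.Tendsto.const_mul (a := (D : ℝ≥0∞)) hA (Or.inr ENNReal.coe_ne_top)
    have hT := ENNReal.Tendsto.const_mul (a := ((2 * τ).toNNReal : ℝ≥0∞)) he
      (Or.inr ENNReal.coe_ne_top)
    have hc := ENNReal.Tendsto.const_mul (a := (X.c : ℝ≥0∞)) (h2.add hD)
      (Or.inr ENNReal.coe_ne_top)
    simpa using hT.add (ENNReal.Tendsto.const_mul (a := (X.c : ℝ≥0∞)) (hc.add h3)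
      (Or.inr ENNReal.coe_ne_top))
  obtain ⟨n, hn⟩ := (ENNReal.tendsto_nhds_zero.1 hlim η hη).exists
  obtain ⟨w, hw, hwτ, hwf⟩ := exists_lipschitzWith_eqOn_fracSharp_le hball hC hfm hτ0 hτ n
  have hleb := ae_isBallLebesguePoint hball hC hint
  -- Off `E n` the equality `f = w` can fail at non-Lebesgue points. Localization needs vanishing at
  -- every point outside the set, so a Borel null set containing them is added.
  let N := toMeasurable μ {x | ¬ IsBallLebesguePoint μ f x}
  have hN : μ N = 0 := (measure_toMeasurable _).trans hleb
  have hF : MeasurableSet (E n ∪ N) := (hEm n).union (measurableSet_toMeasurable _ _)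
  have hEF : (E n ∪ N : Set P) =ᵐ[μ] E n := union_ae_eq_left_of_ae_eq_empty (ae_eq_empty.2 hN)
  have hzero : ∀ x ∉ E n ∪ N, f x = w x := by
    intro x hx
    refine hwf x ?_ ?_
    · by_contra h
      exact hx (Or.inr (subset_toMeasurable _ _ h))
    · have h : ¬ ENNReal.ofReal n < fracSharp μ (fun y => (f y : EReal)) x :=
        fun h => hx (Or.inl h)
      simpa using h
  have hug : IsUpperGradient (fun x => (f x : EReal) - (w x : EReal))
      (fun x => g x + ((D * n : ℝ≥0) : ℝ≥0∞)) := by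
    refine hg.add (IsUpperGradient.of_lipschitzWith hw) fun x y => ?_
    rw [← EReal.coe_sub, ← EReal.coe_sub]
    simp only [EReal.abs_coe_sub_coe]
    rw [← ENNReal.ofReal_add (abs_nonneg _) (abs_nonneg _), sub_sub_sub_comm]
    exact ENNReal.ofReal_le_ofReal (abs_sub _ _)
  have hfw : AEMeasurable (fun x => (f x : EReal) - (w x : EReal)) μ :=
    hfm.coe_real_ereal.ereal_sub hw.continuous.measurable.aemeasurable.coe_real_ereal
  refine ⟨w, ⟨_, hw⟩, _, hug.indicator_add (δ := ((n : ℝ≥0) + 1)⁻¹) (by positivity) hg.1 hF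
    (fun x hx => by simp only [hzero x hx, ← EReal.coe_sub, sub_self, EReal.coe_zero]),
    le_trans (add_le_add ?_ ?_) hn⟩
  · rw [X.nrm_eq_enrm_abs hfw, ← X.enrm_const_mul _ (hone n)]
    refine X.enrm_mono hfw.ereal_abs ((hone n).const_mul _) ?_
    filter_upwards [hEF.mem_iff] with x hx
    rw [EReal.abs_coe_sub_coe]
    by_cases hxE : x ∈ E n
    · simp only [indicator_of_mem hxE, Pi.one_apply, mul_one]
      refine ENNReal.ofReal_le_ofReal ((abs_sub _ _).trans ?_)
      linarith [hτ x, hwτ x]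
    · rw [hzero x (fun h => hxE (hx.1 h))]
      simp
  · refine (X.enrm_indicator_add_le hg.1 hF hEF).trans_eq ?_
    push_cast
    rw [mul_assoc (D : ℝ≥0∞)]

/-- The weak estimate passes to truncations. -/
theorem sharpWeakEstimate_truncation [SFinite μ]
    (hball : ∀ (x : P) (r : ℝ), 0 < r → 0 < μ (Metric.ball x r) ∧ μ (Metric.ball x r) < ∞)
    {X : QuasiBanachFunctionLattice μ} {u : P → EReal} (hu : LocIntegrableOnBalls μ u)
    (h : SharpWeakEstimate X u) {τ : ℝ} (hτ : 0 ≤ τ) :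
    SharpWeakEstimate X (truncation u τ) := by
  have := secondCountableTopology_of_measure_ball_pos fun x r hr => (hball x r hr).1
  let f : P → ℝ := fun x => (hu.1.mk u x).toReal
  have hfm : Measurable f := hu.1.measurable_mk.ereal_toReal
  have hfin : ∀ᵐ y ∂μ, (u y).abs < ∞ := by
    rcases isEmpty_or_nonempty P with hP | ⟨⟨x⟩⟩
    · exact ae_of_all _ fun y => isEmptyElim y
    have hb : ∀ n : ℕ, ∀ᵐ y ∂μ, y ∈ Metric.ball x n → (u y).abs < ∞ := fun n =>
      (ae_restrict_iff' Metric.isOpen_ball.measurableSet).1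
        (ae_lt_top' hu.1.ereal_abs.restrict (hu.2 x n).ne)
    filter_upwards [ae_all_iff.2 hb] with y hy
    obtain ⟨n, hn⟩ := exists_nat_gt (dist y x)
    exact hy n hn
  have huf : ∀ᵐ y ∂μ, u y = f y := by
    filter_upwards [hfin, hu.1.ae_eq_mk] with y hy hmk
    obtain ⟨a, ha⟩ := EReal.exists_coe_eq_of_abs_lt_top hy
    simp only [f]
    rw [← hmk, ha, EReal.toReal_coe]
  have hf : ∀ x r, IntegrableOn f (Metric.ball x r) μ := by
    refine fun x r => ⟨hfm.aestronglyMeasurable, ?_⟩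
    refine (lintegral_congr_ae ?_).trans_lt (hu.2 x r)
    filter_upwards [ae_restrict_of_ae huf] with y hy
    rw [hy, EReal.abs_def, Real.enorm_eq_ofReal_abs]
  have hTf : ∀ x r, IntegrableOn (fun y => clamp τ (f y)) (Metric.ball x r) μ :=
    integrableOn_ball_of_abs_le hball ((lipschitzWith_clamp τ).continuous.measurable.comp
      hfm).aemeasurable fun x => abs_clamp_le hτ (f x)
  have htr : truncation u τ =ᵐ[μ] fun y => (clamp τ (f y) : EReal) := by
    filter_upwards [huf] with y hy using truncation_of_eq_coe hy
  have hle : ∀ x, fracSharp μ (truncation u τ) x ≤ 2 * fracSharp μ u x := by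
    intro x
    rw [fracSharp_congr htr, fracSharp_congr huf]
    exact fracSharp_comp_le hball hf (lipschitzWith_clamp τ) x
  have hm1 : Measurable (fracSharp μ (truncation u τ)) := by
    rw [fracSharp_congr htr]
    exact measurable_fracSharp_coe hball ((lipschitzWith_clamp τ).continuous.measurable.comp hfm) hTf
  have hm2 : Measurable (fracSharp μ u) := by
    rw [fracSharp_congr huf]
    exact measurable_fracSharp_coe hball hfm hf
  -- Since the maximal function at most doubles, `σ χ_{v^♯ > σ} ≤ 2 (σ / 2) χ_{u^♯ > σ / 2}`, and
  -- the hypothesis is used at `σ / 2`.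
  have hlim := ENNReal.Tendsto.const_mul (a := 2)
    (h.comp (tendsto_id.atTop_div_const (zero_lt_two' ℝ))) (Or.inr ENNReal.ofNat_ne_top)
  rw [mul_zero] at hlim
  refine tendsto_of_tendsto_of_tendsto_of_le_of_le' tendsto_const_nhds hlim
    (Eventually.of_forall fun _ => zero_le) ?_
  filter_upwards [eventually_gt_atTop 0] with σ hσ
  have hmeas1 : AEMeasurable ({x | ENNReal.ofReal σ < fracSharp μ (truncation u τ) x}.indicator
      fun _ => (σ : EReal)) μ :=
    (measurable_const.indicator (measurableSet_lt measurable_const hm1)).aemeasurable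
  have hmeas2 : AEMeasurable ({x | ENNReal.ofReal (σ / 2) < fracSharp μ u x}.indicator
      fun _ => ((σ / 2 : ℝ) : EReal)) μ :=
    (measurable_const.indicator (measurableSet_lt measurable_const hm2)).aemeasurable
  have hsm := X.nrm_smul 2 _ hmeas2
  rw [abs_of_pos zero_lt_two, ENNReal.ofReal_ofNat] at hsm
  refine le_trans (X.nrm_mono _ _ hmeas1 (hmeas2.const_mul _) (ae_of_all _ fun x => ?_)) hsm.le
  by_cases hx : ENNReal.ofReal σ < fracSharp μ (truncation u τ) x
  · have hx' : ENNReal.ofReal (σ / 2) < fracSharp μ u x := by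
      have h2 := hx.trans_le (hle x)
      rw [show σ = 2 * (σ / 2) by ring, ENNReal.ofReal_mul zero_le_two, ENNReal.ofReal_ofNat] at h2
      exact lt_of_mul_lt_mul_left' h2
    rw [indicator_of_mem (by exact hx), indicator_of_mem (by exact hx'), ← EReal.coe_mul,
      mul_div_cancel₀ _ (two_ne_zero' ℝ)]
  · rw [indicator_of_notMem (by exact hx), EReal.abs_zero]
    exact zero_le

end SharpApproximation

/-! ### Combination of the two approximations -/

theorem mainTheorem7 {P : Type*} [MetricSpace P] [MeasurableSpace P] [BorelSpace P]
    (μ : Measure P) [SigmaFinite μ] (hnonatomic : IsNonatomic μ)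
    (hball : ∀ (x : P) (r : ℝ), 0 < r →
      0 < μ (Metric.ball x r) ∧ μ (Metric.ball x r) < ∞)
    (hdoubling : ∃ C : ℝ≥0, ∀ (x : P) (r : ℝ), 0 < r →
      μ (Metric.ball x (2 * r)) ≤ C * μ (Metric.ball x r))
    (X : QuasiBanachFunctionLattice μ) (hX : X.AbsolutelyContinuousNorm)
    (u : P → EReal) (hu : X.MemNewton u)
    (hsharp : (∀ τ : ℝ, 0 < τ → SharpWeakEstimate X (truncation u τ)) ∨
      (LocIntegrableOnBalls μ u ∧ SharpWeakEstimate X u)) :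
    ∀ ε : ℝ, 0 < ε → ∃ w : P → ℝ, (∃ K : ℝ≥0, LipschitzWith K w) ∧
      X.MemNewton (fun x => (w x : EReal)) ∧
      X.newtonNorm (fun x => u x - (w x : EReal)) < ENNReal.ofReal ε := by
  intro ε hε
  obtain ⟨C, hC⟩ := hdoubling
  have htrunc : ∀ τ : ℝ, 0 < τ → SharpWeakEstimate X (truncation u τ) :=
    hsharp.elim id fun h τ hτ => sharpWeakEstimate_truncation hball h.1 h.2 hτ.le
  obtain ⟨g, hg, hgfin⟩ := exists_isUpperGradient_of_memNewton hu
  have hunrm : X.nrm u < ∞ := (ENNReal.add_lt_top.1 hu.2).1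
  -- Each approximation contributes at most `η`, and the quasi-triangle inequality multiplies their
  -- sum by `c`.
  obtain ⟨η, hη, hηε⟩ := ENNReal.exists_nnreal_pos_mul_lt
    (a := 2 * X.c) (b := ENNReal.ofReal ε) (by finiteness) (by simpa using hε)
  have hη' : (0 : ℝ≥0∞) < η := by exact_mod_cast hη
  obtain ⟨τ, hτ, h₁, hug₁, hle₁⟩ := exists_truncation_approx hX ⟨hu.1, hunrm⟩ hg hgfin hη'
  choose f hfτ hf using exists_truncation_eq_coe (u := u) hτ.le
  have hveq : truncation u τ = fun x => (f x : EReal) := funext hf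
  have hvm : AEMeasurable (fun x => (f x : EReal)) μ := hveq ▸ hu.1.truncation τ
  have hfm : AEMeasurable f μ := by simpa using hvm.ereal_toReal
  have hvg : IsUpperGradient (fun x => (f x : EReal)) g :=
    hveq ▸ hg.mono_abs_sub (abs_truncation_sub_le τ)
  obtain ⟨w, hw, h₂, hug₂, hle₂⟩ := exists_lipschitz_approx hball hC hX hfm hτ.le hfτ hvg hgfin
    (hveq ▸ htrunc τ hτ) hη'
  simp only [hf] at hug₁ hle₁
  have hwm : AEMeasurable (fun x => (w x : EReal)) μ := by
    obtain ⟨K, hK⟩ := hw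
    exact hK.continuous.measurable.aemeasurable.coe_real_ereal
  have hm₁ := hu.1.ereal_sub hvm
  have hm₂ := hvm.ereal_sub hwm
  have hvnrm : X.nrm (fun x => (f x : EReal)) < ∞ :=
    (X.nrm_mono _ _ hvm hu.1 (ae_of_all _ fun x => hf x ▸ abs_truncation_le hτ.le x)).trans_lt hunrm
  refine ⟨w, hw, ⟨hwm, ?_⟩, ?_⟩
  -- Membership of `w` follows from `w = f - (f - w)`, both terms having finite Newtonian norm.
  · refine (X.newtonNorm_le_of_abs_le hvm hm₂ hwm hvg hug₂ (fun x => ?_) (fun x y => ?_)).trans_lt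
      (ENNReal.mul_lt_top ENNReal.coe_lt_top (ENNReal.add_lt_top.2
        ⟨ENNReal.add_lt_top.2 ⟨hvnrm, hgfin⟩, hle₂.trans_lt ENNReal.coe_lt_top⟩))
    · rw [EReal.abs_coe_sub_coe, EReal.abs_def, EReal.abs_def,
        ← ENNReal.ofReal_add (abs_nonneg _) (abs_nonneg _)]
      refine ENNReal.ofReal_le_ofReal ?_
      have := abs_sub (f x) (f x - w x)
      rwa [sub_sub_cancel] at this
    · simp only [← EReal.coe_sub, EReal.abs_def]
      rw [← ENNReal.ofReal_add (abs_nonneg _) (abs_nonneg _)]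
      refine ENNReal.ofReal_le_ofReal ?_
      have := abs_sub (f x - f y) ((f x - w x) - (f y - w y))
      rwa [sub_sub_sub_comm (f x) (f y), sub_sub_cancel, sub_sub_cancel] at this
  · refine (X.newtonNorm_le_of_abs_le hm₁ hm₂ (hu.1.ereal_sub hwm) hug₁ hug₂ (fun x => ?_)
      (fun x y => ?_)).trans_lt ?_
    · by_cases h : (u x).abs < ∞
      · obtain ⟨a, ha⟩ := EReal.exists_coe_eq_of_abs_lt_top h
        rw [ha, EReal.abs_coe_sub_coe, EReal.abs_coe_sub_coe, EReal.abs_coe_sub_coe]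
        simpa using ENNReal.ofReal_abs_add_le (a - f x) (f x - w x)
      -- Where `u` is infinite, so is `|u - f|`, as `f` is real; the bound is then trivial.
      · refine le_top.trans (le_add_right ?_)
        induction hux : u x <;> simp [hux, EReal.abs_def] at h ⊢
    · by_cases h : (u x).abs < ∞ ∧ (u y).abs < ∞
      · obtain ⟨a, ha⟩ := EReal.exists_coe_eq_of_abs_lt_top h.1
        obtain ⟨b, hb⟩ := EReal.exists_coe_eq_of_abs_lt_top h.2
        simp only [ha, hb, ← EReal.coe_sub, EReal.abs_def]
        have := ENNReal.ofReal_abs_add_le ((a - f x) - (b - f y)) ((f x - w x) - (f y - w y))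
        rwa [show (a - f x) - (b - f y) + ((f x - w x) - (f y - w y)) =
          (a - w x) - (b - w y) by ring] at this
      -- If `u x` or `u y` is infinite, the increment of `u - f` is infinite as well, by the
      -- convention for differences of infinities.
      · refine le_top.trans (le_add_right ?_)
        induction hux : u x <;> induction huy : u y <;> simp [hux, huy, ← EReal.coe_sub, EReal.abs_def] at h ⊢
    · refine lt_of_le_of_lt (mul_le_mul_right (add_le_add hle₁ hle₂) _) ?_
      refine lt_of_eq_of_lt ?_ hηε
      ring
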